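/- Let $g_*$ be the round metric of the unit sphere $\mathbb S^2$. For a Riemannian metric $\gamma$ on $I\times\mathbb S^2$ ($I\subseteq\mathbb R$ an interval) and a vector field $E$ (the electric field), let $R(\gamma)$ be the scalar curvature, $\Sigma_s=\{s\}\times\mathbb S^2$, $\nu$ the unit normal of $\Sigma_s$ in the direction of increasing $s$, $H=\operatorname{div}_\gamma\nu$ its mean curvature, $|\Sigma_s|$ its area, $\mathbf Q_{\Sigma_s}=\frac1{4\pi}\int_{\Sigma_s}\gamma(E,\nu)\,d\sigma$ the charge contained in it, and $$\mathfrak m_H^{CH}(\Sigma_s)=\sqrt{\frac{|\Sigma_s|}{16\pi}}\left(1+\frac{4\pi \mathbf Q_{\Sigma_s}^2}{|\Sigma_s|}-\frac1{16\pi}\int_{\Sigma_s}H^2\,d\sigma\right)$$ its charged Hawking mass. For $m>|Q|$ put $r_+=m+\sqrt{m^2-Q^2}$; the sub-extremal Reissner–Nordström space of mass $m$ and charge $Q$ is $(r_+,\infty)\times\mathbb S^2$ with $$\gamma_{m,Q}=\Bigl(1-\tfrac{2m}r+\tfrac{Q^2}{r^2}\Bigr)^{-1}dr^2+r^2g_*,\qquad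 E_{m,Q}=\tfrac{Q}{r^2}\sqrt{1-\tfrac{2m}r+\tfrac{Q^2}{r^2}}\;\partial_r .$$ **Proposition.** Let $a<b$, let $f:[a,b]\to(0,\infty)$ be smooth, let $\gamma_f=ds^2+f(s)^2g_*$ on $[a,b]\times\mathbb S^2$, let $Q\in\mathbb R$ and $E_f=Qf^{-2}\partial_s$. Suppose that (i) $R(\gamma_f)>2|E_f|^2_{\gamma_f}$ on $[a,b]\times\mathbb S^2$; (ii) $f(b)>|Q|$; (iii) the mean curvature of $\Sigma_b$ is positive; (iv) $\mathfrak m_H^{CH}(\Sigma_b)>|Q|$. Then for every $m_e>\mathfrak m_H^{CH}(\Sigma_b)$ there is a rotationally symmetric charged Riemannian manifold $(M,\gamma,E)$, $$M=[a,\infty)\times\mathbb S^2,\qquad \gamma=ds^2+F(s)^2g_*,\qquad E=\varphi(s)\,\partial_s,$$ with $F>0$ and $\varphi$ smooth on $[a,\infty)$, which satisfies $\operatorname{div}_\gamma E=0$ and the dominant energy condition $R(\gamma)\ge 2|E|^2_\gamma$, and which is asymptotically flat (the complement of a compact set has coordinates $x$ onto the exterior of a ball in $\mathbb R^3$ in which,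 as $|x|\to\infty$, $\gamma_{ij}-\delta_{ij}=O(|x|^{-1})$ with first and second derivatives $O(|x|^{-2})$ and $O(|x|^{-3})$, $E^i=O(|x|^{-2})$ with first derivatives $O(|x|^{-3})$, and $R(\gamma)$ is integrable), such that (I) on $[a,\frac{a+b}2]\times\mathbb S^2$, a neighborhood of $\partial M=\Sigma_a$, one has $\gamma=\gamma_f$ and $E=E_f$; (II) for some $s_1>a$ and $r_1>r_+$ (with $m=m_e$) there is an isometry $\Phi$ of $([s_1,\infty)\times\mathbb S^2,\gamma)$ onto the part $\{r\ge r_1\}$ of the Reissner–Nordström space of mass $m_e$ and charge $Q$, which carries $E$ to $E_{m_e,Q}$; (III) if $f'>0$ on $[a,b]$, then all the spheres $\Sigma_s$, $s\ge a$, which foliate $M$, have positive mean curvature, and for $s\ge s_1$ the isometry $\Phi$ maps $\Sigma_s$ onto a coordinate sphere $\{r\}\times\mathbb S^2$ of the Reissner–Nordström space. -/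

import Mathlib

open Set MeasureTheory
open scoped Manifold ContDiff

noncomputable section

/-- Euclidean three-space. -/
abbrev E3 : Type := EuclideanSpace ℝ (Fin 3)

/-- The unit sphere of Euclidean three-space, with the smooth structure of Mathlib. -/
abbrev S2 : Type := Metric.sphere (0 : E3) 1

instance : Fact (Module.finrank ℝ E3 = 2 + 1) := ⟨by simp⟩

/-- The cylinder `ℝ × S²`. All the cylinders `I × S²` below, `I` an interval, are regions of it. -/
abbrev Cyl : Type := ℝ × S2

/-- The model vector space of the cylinder. -/
abbrev CylV : Type := ℝ × EuclideanSpace ℝ (Fin 2)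

/-- The model of the manifold `ℝ × S²`. -/
abbrev cylModel : ModelWithCorners ℝ CylV (ModelProd ℝ (EuclideanSpace ℝ (Fin 2))) :=
  𝓘(ℝ, ℝ).prod (𝓡 2)

/-- The region `I × S²`. If `I` is a closed interval this is a manifold with boundary. -/
def cyl (I : Set ℝ) : Set Cyl := I ×ˢ (univ : Set S2)

/-- The coordinate sphere `Σ_s = {s} × S²`. -/
def coordSphere (s : ℝ) : Set Cyl := cyl {s}

/-- (Unbundled) fields of bilinear forms on the tangent spaces. -/
abbrev CylMetric : Type := (p : Cyl) → TangentSpace cylModel p → TangentSpace cylModel p → ℝ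

/-- (Unbundled) vector fields. -/
abbrev CylField : Type := (p : Cyl) → TangentSpace cylModel p

/-- The differential at `θ` of the inclusion of the unit sphere into `ℝ³`. -/
def inclDeriv (θ : S2) (v : TangentSpace (𝓡 2) θ) : E3 :=
  mvfderiv (𝓡 2) (fun x : S2 => (x : E3)) θ v

/-- The round metric `g_*`: the metric induced on the unit sphere by its inclusion into `ℝ³`. -/
def roundMetric (θ : S2) (v w : TangentSpace (𝓡 2) θ) : ℝ :=
  inner ℝ (inclDeriv θ v) (inclDeriv θ w)

/-- The metric `h(s) ds² + f(s)² g_*`. -/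
def warpedMetric (h f : ℝ → ℝ) : CylMetric := fun p v w =>
  h p.1 * ((v : CylV).1 * (w : CylV).1) + f p.1 ^ 2 * roundMetric p.2 (v : CylV).2 (w : CylV).2

/-- The metric `γ_f = ds² + f(s)² g_*`. -/
def rotMetric (f : ℝ → ℝ) : CylMetric := warpedMetric (fun _ => 1) f

/-- The vector field `φ(s) ∂_s`. -/
def radialField (φ : ℝ → ℝ) : CylField := fun p => ((φ p.1, 0) : CylV)

/-- The electric field `E_f = Q f⁻² ∂_s`. -/
def electricField (Q : ℝ) (f : ℝ → ℝ) : CylField := radialField (fun s => Q / f s ^ 2)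

/-! ### Tensor calculus in a coordinate domain

`b` is a basis of the coordinate space `V`, `D` the coordinate domain (derivatives are taken within
`D`, hence are one-sided at boundary points), `G` the matrix of the metric. -/

section Coord

variable {ι V : Type} [Fintype ι] [DecidableEq ι] [NormedAddCommGroup V] [NormedSpace ℝ V]

/-- The partial derivative `∂_i u`. -/
def pderiv (b : Module.Basis ι ℝ V) (D : Set V) (i : ι) (u : V → ℝ) (y : V) : ℝ :=
  fderivWithin ℝ u D y (b i)

/-- The Christoffel symbol `Γ^k_{ij}`. -/
def christoffel (b : Module.Basis ι ℝ V) (D : Set V) (G : V → Matrix ι ι ℝ) (k i j : ι) (y : V) :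
    ℝ :=
  (1 / 2) * ∑ l, (G y)⁻¹ k l *
    (pderiv b D i (fun z => G z j l) y + pderiv b D j (fun z => G z i l) y
      - pderiv b D l (fun z => G z i j) y)

/-- The Ricci curvature `∂_k Γ^k_{ij} - ∂_j Γ^k_{ik} + Γ^k_{kl} Γ^l_{ij} - Γ^k_{jl} Γ^l_{ik}`. -/
def coordRicci (b : Module.Basis ι ℝ V) (D : Set V) (G : V → Matrix ι ι ℝ) (i j : ι) (y : V) : ℝ :=
  ∑ k, (pderiv b D k (christoffel b D G k i j) y - pderiv b D j (christoffel b D G k i k) y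
    + ∑ l, (christoffel b D G k k l y * christoffel b D G l i j y
      - christoffel b D G k j l y * christoffel b D G l i k y))

/-- The scalar curvature `g^{ij} Ric_{ij}`. -/
def coordScalar (b : Module.Basis ι ℝ V) (D : Set V) (G : V → Matrix ι ι ℝ) (y : V) : ℝ :=
  ∑ i, ∑ j, (G y)⁻¹ i j * coordRicci b D G i j y

/-- The divergence `∂_i X^i + Γ^i_{ij} X^j`. -/
def coordDiv (b : Module.Basis ι ℝ V) (D : Set V) (G : V → Matrix ι ι ℝ) (X : V → ι → ℝ) (y : V) :
    ℝ :=
  ∑ i, (pderiv b D i (fun z => X z i) y + ∑ j, christoffel b D G i i j y * X y j)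

/-- The unit normal `∇τ / |∇τ|` of the level sets of `τ`. -/
def coordNormal (b : Module.Basis ι ℝ V) (D : Set V) (G : V → Matrix ι ι ℝ) (τ : V → ℝ) (y : V) :
    ι → ℝ := fun i =>
  (∑ j, (G y)⁻¹ i j * pderiv b D j τ y) /
    Real.sqrt (∑ k, ∑ l, (G y)⁻¹ k l * pderiv b D k τ y * pderiv b D l τ y)

end Coord

/-! ### Geometry of a region of the cylinder

At the point `p` everything is computed in Mathlib's preferred chart of `ℝ × S²` at `p`. -/

/-- The standard basis of the model space. -/
def cylBasis : Module.Basis (Unit ⊕ Fin 2) ℝ CylV :=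
  (Module.Basis.singleton Unit ℝ).prod (EuclideanSpace.basisFun (Fin 2) ℝ).toBasis

/-- The part of the region `M` covered by the chart at `p`, in coordinates. -/
def chartDomain (M : Set Cyl) (p : Cyl) : Set CylV :=
  (extChartAt cylModel p).target ∩ (extChartAt cylModel p).symm ⁻¹' M

/-- The matrix of `γ` in the chart at `p`. -/
def chartMetric (γ : CylMetric) (p : Cyl) (y : CylV) : Matrix (Unit ⊕ Fin 2) (Unit ⊕ Fin 2) ℝ :=
  fun i j => γ ((extChartAt cylModel p).symm y)
    (mfderiv 𝓘(ℝ, CylV) cylModel (extChartAt cylModel p).symm y (cylBasis i))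
    (mfderiv 𝓘(ℝ, CylV) cylModel (extChartAt cylModel p).symm y (cylBasis j))

/-- The components of the vector field `E` in the chart at `p`. -/
def chartField (E : CylField) (p : Cyl) (y : CylV) : Unit ⊕ Fin 2 → ℝ := fun i =>
  cylBasis.repr (mvfderiv cylModel (extChartAt cylModel p)
    ((extChartAt cylModel p).symm y) (E ((extChartAt cylModel p).symm y))) i

/-- The scalar curvature `R(γ)` of `(M, γ)`. -/
def scalarCurvature (M : Set Cyl) (γ : CylMetric) (p : Cyl) : ℝ :=
  coordScalar cylBasis (chartDomain M p) (chartMetric γ p) (extChartAt cylModel p p)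

/-- The divergence of the vector field `E` on `(M, γ)`. -/
def divergence (M : Set Cyl) (γ : CylMetric) (E : CylField) (p : Cyl) : ℝ :=
  coordDiv cylBasis (chartDomain M p) (chartMetric γ p) (chartField E p) (extChartAt cylModel p p)

/-- The components, in the chart at `p`, of the unit normal `ν` of the coordinate spheres that
points in the direction of increasing `s`. -/
def chartNormal (M : Set Cyl) (γ : CylMetric) (p : Cyl) : CylV → Unit ⊕ Fin 2 → ℝ :=
  coordNormal cylBasis (chartDomain M p) (chartMetric γ p)
    (fun y => ((extChartAt cylModel p).symm y).1)

/-- The mean curvature at `p` of the coordinate sphere through `p`: the divergence of `ν`. -/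
def meanCurvature (M : Set Cyl) (γ : CylMetric) (p : Cyl) : ℝ :=
  coordDiv cylBasis (chartDomain M p) (chartMetric γ p) (chartNormal M γ p)
    (extChartAt cylModel p p)

/-- The normal component `γ(E, ν)`. -/
def normalComponent (M : Set Cyl) (γ : CylMetric) (E : CylField) (p : Cyl) : ℝ :=
  ∑ i, ∑ j, chartMetric γ p (extChartAt cylModel p p) i j *
    chartField E p (extChartAt cylModel p p) i * chartNormal M γ p (extChartAt cylModel p p) j

/-- The density of the area form of `Σ_s` with respect to that of the unit sphere: the square root
of the ratio of the Gram determinants of a basis of the tangent space of the sphere. -/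
def areaDensity (γ : CylMetric) (s : ℝ) (θ : S2) : ℝ :=
  let e : Fin 2 → EuclideanSpace ℝ (Fin 2) := EuclideanSpace.basisFun (Fin 2) ℝ
  Real.sqrt
    (Matrix.det (Matrix.of fun i j : Fin 2 => γ (s, θ) ((0, e i) : CylV) ((0, e j) : CylV)) /
      Matrix.det (Matrix.of fun i j : Fin 2 => roundMetric θ (e i) (e j)))

/-- The integral `∫_{Σ_s} u dσ`; `volume.toSphere` is the area measure of the unit sphere. -/
def sphereIntegral (γ : CylMetric) (s : ℝ) (u : Cyl → ℝ) : ℝ :=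
  ∫ θ : S2, u (s, θ) * areaDensity γ s θ ∂((volume : Measure E3).toSphere)

/-- The area `|Σ_s|`. -/
def sphereArea (γ : CylMetric) (s : ℝ) : ℝ := sphereIntegral γ s (fun _ => 1)

/-- The charge contained in `Σ_s`. -/
def sphereCharge (M : Set Cyl) (γ : CylMetric) (E : CylField) (s : ℝ) : ℝ :=
  1 / (4 * Real.pi) * sphereIntegral γ s (normalComponent M γ E)

/-- The charged Hawking mass of `Σ_s`. -/
def chargedHawkingMass (M : Set Cyl) (γ : CylMetric) (E : CylField) (s : ℝ) : ℝ :=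
  Real.sqrt (sphereArea γ s / (16 * Real.pi)) *
    (1 + 4 * Real.pi * sphereCharge M γ E s ^ 2 / sphereArea γ s
      - 1 / (16 * Real.pi) * sphereIntegral γ s (fun p => meanCurvature M γ p ^ 2))

/-- `Φ` is an isometry of `(K, γ, E)` onto `(L, γ', E')`: a diffeomorphism that carries the metric
to the metric and the field to the field. -/
def IsChargedIsometry (K : Set Cyl) (γ : CylMetric) (E : CylField)
    (L : Set Cyl) (γ' : CylMetric) (E' : CylField) (Φ : Cyl → Cyl) : Prop :=
  BijOn Φ K L ∧ ContMDiffOn cylModel cylModel ∞ Φ K ∧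
  (∃ Ψ : Cyl → Cyl, ContMDiffOn cylModel cylModel ∞ Ψ L ∧ InvOn Ψ Φ K L) ∧
  ∀ p ∈ K,
    (∀ v w : TangentSpace cylModel p,
      γ' (Φ p) (mfderivWithin cylModel cylModel Φ K p v) (mfderivWithin cylModel cylModel Φ K p w)
        = γ p v w) ∧
    mfderivWithin cylModel cylModel Φ K p (E p) = E' (Φ p)

/-- The outer radius `r₊ = m + √(m² - Q²)`. -/
def rPlus (m Q : ℝ) : ℝ := m + Real.sqrt (m ^ 2 - Q ^ 2)

/-- The Reissner–Nordström metric `(1 - 2m/r + Q²/r²)⁻¹ dr² + r² g_*` on `(r₊, ∞) × S²`. -/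
def rnMetric (m Q : ℝ) : CylMetric :=
  warpedMetric (fun r => (1 - 2 * m / r + Q ^ 2 / r ^ 2)⁻¹) (fun r => r)

/-- The Reissner–Nordström field `Q r⁻² √(1 - 2m/r + Q²/r²) ∂_r`. -/
def rnField (m Q : ℝ) : CylField :=
  radialField (fun r => Q / r ^ 2 * Real.sqrt (1 - 2 * m / r + Q ^ 2 / r ^ 2))

/-- The partial derivative `∂_k u` in `ℝ³`. -/
def partialE3 (k : Fin 3) (u : E3 → ℝ) (x : E3) : ℝ :=
  fderiv ℝ u x (EuclideanSpace.basisFun (Fin 3) ℝ k)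

/-- The components `γ_ij = γ(∂Φ/∂x_i, ∂Φ/∂x_j)` of `γ` in coordinates `x = Φ⁻¹(p)`. -/
def afMetric (γ : CylMetric) (Φ : E3 → Cyl) (i j : Fin 3) (x : E3) : ℝ :=
  γ (Φ x) (mfderiv 𝓘(ℝ, E3) cylModel Φ x (EuclideanSpace.basisFun (Fin 3) ℝ i))
    (mfderiv 𝓘(ℝ, E3) cylModel Φ x (EuclideanSpace.basisFun (Fin 3) ℝ j))

/-- The components of `E` in coordinates `x = Ψ(p)`, where `Φ = Ψ⁻¹`. -/
def afField (E : CylField) (Φ : E3 → Cyl) (Ψ : Cyl → E3) (i : Fin 3) (x : E3) : ℝ :=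
  (mvfderiv cylModel Ψ (Φ x) (E (Φ x))).ofLp i

/-- `(M, γ, E)` is asymptotically flat with one end: outside a compact set there are coordinates
`x = Ψ(p)` with values in the exterior of a ball of `ℝ³` (`Φ` is the inverse of `Ψ`), in which
`γ_ij - δ_ij = O₂(|x|⁻¹)` and `E^i = O₁(|x|⁻²)`, and the scalar curvature is integrable. -/
def IsAsymptoticallyFlat (M : Set Cyl) (γ : CylMetric) (E : CylField) : Prop :=
  ∃ (R C : ℝ) (Φ : E3 → Cyl) (Ψ : Cyl → E3),
    0 < R ∧
    MapsTo Φ {x | R < ‖x‖} M ∧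
    IsCompact (M \ Φ '' {x | R < ‖x‖}) ∧
    IsOpen (Φ '' {x | R < ‖x‖}) ∧
    LeftInvOn Ψ Φ {x | R < ‖x‖} ∧
    ContMDiffOn 𝓘(ℝ, E3) cylModel ∞ Φ {x | R < ‖x‖} ∧
    ContMDiffOn cylModel 𝓘(ℝ, E3) ∞ Ψ (Φ '' {x | R < ‖x‖}) ∧
    (∀ x, R < ‖x‖ → ∀ i j k l,
      |afMetric γ Φ i j x - (if i = j then 1 else 0)| ≤ C / ‖x‖ ∧
      |partialE3 k (afMetric γ Φ i j) x| ≤ C / ‖x‖ ^ 2 ∧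
      |partialE3 l (partialE3 k (afMetric γ Φ i j)) x| ≤ C / ‖x‖ ^ 3 ∧
      |afField E Φ Ψ i x| ≤ C / ‖x‖ ^ 2 ∧
      |partialE3 k (afField E Φ Ψ i) x| ≤ C / ‖x‖ ^ 3) ∧
    IntegrableOn (fun x => scalarCurvature M γ (Φ x)) {x | R < ‖x‖}

end

noncomputable section

/-! For `γ = ds² + F² g_*` and `E = Q F⁻² ∂_s`, the divergence of `E` vanishes identically, the mean
curvature of `Σ_s` is `2F'/F`, and the charged Hawking mass is `M = (F/2)(1 - F'² + Q²/F²)`.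
Moreover `M' = (F'/2)(1 - F'² - 2FF'' - Q²/F²)`, and the bracket is `(F²/2)(R - 2|E|²)`. So where
`F' > 0` the dominant energy condition says exactly that `M` is nondecreasing. Prescribing the
metric amounts to prescribing radius and mass, since `F' = √V` with `V = 1 - 2M/F + Q²/F²`; constant
mass `m` gives Reissner–Nordström.

The extension is therefore built in an auxiliary parameter `t` (`exists_radius_mass`): a radius `ρ`
with `ρ' > 0` and a mass `μ` with `μ' ≥ 0`, equal to those of `f` at first and to `t + κ` and `m` in
the end. The one constraint is `V > 0`. It is secured by raising the mass in two stages. Just before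
`b` it rises only to some `c` slightly above the Hawking mass of `Σ_b`, with `2c < f + Q²/f`; since
`r + Q²/r` increases for `r > |Q|`, this inequality survives as the radius grows. Once `ρ > 2m` the
mass can rise to `m` without danger.

Arc length is then recovered from `ds = ρ' dt / √V` (`exists_profile_of_Ioo`, with
`exists_diffeo_of_deriv`): in terms of `s` the radius satisfies `F' = √V`, so its mass is `μ` and
the energy condition is `μ' ≥ 0`. On the original piece `√V = f' = ρ'`, so `s = t` there and nothing
is changed. The needed inequalities at `b` are open, hence hold on a short interval to its left
(`exists_profile`).

The curvature formulas are computed in stereographic coordinates (`coordScalar_rot`,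
`coordDiv_rot`). On the end, `x = F(s)θ` gives asymptotically flat coordinates, controlled by a
calculus of functions with decaying derivatives (`HasDecay`), and `(s, θ) ↦ (F(s), θ)` is the
isometry with Reissner–Nordström. -/

/-! ### Stereographic charts of the sphere and of the cylinder. -/

/-- The inverse of the preferred chart of the sphere at `θ`, as a map into `ℝ³`. -/
def stereoEmb (θ : S2) (w : EuclideanSpace ℝ (Fin 2)) : E3 := ((extChartAt (𝓡 2) θ).symm w : S2)

theorem extChartAt_sphere_target (θ : S2) : (extChartAt (𝓡 2) θ).target = univ := by
  simp [extChartAt, chartAt, ChartedSpace.chartAt]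

/-- The preferred chart at `θ` projects from the antipode `-θ`, so `θ` itself goes to the origin.
Pointwise geometry therefore only has to be evaluated at `w = 0`. -/
theorem extChartAt_sphere_self (θ : S2) : extChartAt (𝓡 2) θ θ = 0 := by
  have h : (stereographic (norm_eq_of_mem_sphere (-θ))) θ = 0 := stereographic_neg_apply θ
  exact (congrArg (OrthonormalBasis.fromOrthogonalSpanSingleton (𝕜 := ℝ) (E := E3) 2
      (ne_zero_of_mem_unit_sphere (-θ))).repr h).trans (map_zero _)

theorem exists_stereoEmb_eq (θ : S2) : ∃ J : EuclideanSpace ℝ (Fin 2) →ₗᵢ[ℝ] E3,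
    (∀ w, inner ℝ (J w) (θ : E3) = 0) ∧
    ∀ w, stereoEmb θ w = (‖w‖ ^ 2 + 4)⁻¹ • ((4 : ℝ) • J w + (‖w‖ ^ 2 - 4) • (-(θ : E3))) := by
  let U := (OrthonormalBasis.fromOrthogonalSpanSingleton (𝕜 := ℝ) (E := E3) 2
      (ne_zero_of_mem_unit_sphere (-θ))).repr
  refine ⟨(Submodule.subtypeₗᵢ _).comp U.symm.toLinearIsometry, fun w => ?_, fun w => ?_⟩
  · have := Submodule.mem_orthogonal_singleton_iff_inner_left.1 (U.symm w).2
    exact neg_eq_zero.1 ((inner_neg_right _ _).symm.trans this)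
  · have := stereographic'_symm_apply (n := 2) (-θ) w
    simp only [stereoEmb]
    refine this.trans ?_
    rw [smul_add]
    have h : ‖((U.symm w : _) : E3)‖ = ‖w‖ := U.symm.norm_map w
    change _ = (‖w‖ ^ 2 + 4)⁻¹ • (4 : ℝ) • ((U.symm w : _) : E3) +
      (‖w‖ ^ 2 + 4)⁻¹ • (‖w‖ ^ 2 - 4) • (-(θ : E3))
    rw [← h]
    rfl

/-- Stereographic projection is conformal: after expanding, the terms in `⟨w, u⟩⟨w, v⟩` cancel. -/
theorem inner_fderiv_stereoEmb (θ : S2) (w u v : EuclideanSpace ℝ (Fin 2)) :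
    inner ℝ (fderiv ℝ (stereoEmb θ) w u) (fderiv ℝ (stereoEmb θ) w v) =
      16 / (‖w‖ ^ 2 + 4) ^ 2 * inner ℝ u v := by
  obtain ⟨J, hJ, h⟩ := exists_stereoEmb_eq θ
  have hq : ‖w‖ ^ 2 + 4 ≠ 0 := by positivity
  have h0 : HasFDerivAt (fun w : EuclideanSpace ℝ (Fin 2) => ‖w‖ ^ 2) (2 • innerSL ℝ w) w :=
    (hasStrictFDerivAt_norm_sq w).hasFDerivAt
  have h1 := ((hasDerivAt_inv hq).comp_hasFDerivAt w (h0.add_const 4))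
  have h2 := ((J.toContinuousLinearMap.hasFDerivAt (x := w)).const_smul (4:ℝ)).add
    ((h0.sub_const 4).smul_const (-(θ : E3)))
  have h3 := h1.smul h2
  have h4 : ∀ u, fderiv ℝ (stereoEmb θ) w u = (4 / (‖w‖ ^ 2 + 4)) • J u
      - (8 * inner ℝ w u / (‖w‖ ^ 2 + 4) ^ 2) • J w
      - (16 * inner ℝ w u / (‖w‖ ^ 2 + 4) ^ 2) • (θ : E3) := by
    intro u
    rw [funext h]
    refine (congrArg (fun A => A u) h3.fderiv).trans ?_
    simp
    match_scalars <;> field_simp <;> ring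
  have hθ : inner ℝ (θ : E3) (θ : E3) = 1 := by simp
  have hJ' : ∀ w, inner ℝ (θ : E3) (J w) = 0 := fun w => by rw [real_inner_comm]; exact hJ w
  simp only [h4, inner_sub_left, inner_sub_right, inner_smul_left, inner_smul_right, hJ, hJ', hθ,
    J.inner_map_map]
  rw [real_inner_self_eq_norm_sq, real_inner_comm w u]
  simp
  field_simp
  ring

theorem mdifferentiableAt_extChartAt_sphere_symm (θ : S2) (y : EuclideanSpace ℝ (Fin 2)) :
    MDifferentiableAt 𝓘(ℝ, EuclideanSpace ℝ (Fin 2)) (𝓡 2) (extChartAt (𝓡 2) θ).symm y := by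
  have := (contMDiffOn_extChartAt_symm (I := 𝓡 2) (n := 1) θ)
  rw [extChartAt_sphere_target] at this
  exact (this.contMDiffAt Filter.univ_mem).mdifferentiableAt one_ne_zero

theorem inclDeriv_mfderiv_symm (θ : S2) (y : EuclideanSpace ℝ (Fin 2))
    (v : EuclideanSpace ℝ (Fin 2)) :
    inclDeriv ((extChartAt (𝓡 2) θ).symm y)
      (mfderiv 𝓘(ℝ, EuclideanSpace ℝ (Fin 2)) (𝓡 2) (extChartAt (𝓡 2) θ).symm y v) =
      fderiv ℝ (stereoEmb θ) y v := by
  have h1 : MDifferentiableAt (𝓡 2) 𝓘(ℝ, E3) (fun x : S2 => (x : E3))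
      ((extChartAt (𝓡 2) θ).symm y) := (contMDiff_coe_sphere (m := 1) _).mdifferentiableAt one_ne_zero
  have h2 := mdifferentiableAt_extChartAt_sphere_symm θ y
  have h3 := mfderiv_comp_apply y h1 h2 v
  have h4 : mfderiv 𝓘(ℝ, EuclideanSpace ℝ (Fin 2)) 𝓘(ℝ, E3)
    ((fun x : S2 => (x : E3)) ∘ (extChartAt (𝓡 2) θ).symm) y = fderiv ℝ (stereoEmb θ) y :=
    mfderiv_eq_fderiv
  rw [h4] at h3
  exact h3.symm

theorem extChartAt_cyl_symm (p : Cyl) (y : CylV) :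
    (extChartAt cylModel p).symm y = (y.1, (extChartAt (𝓡 2) p.2).symm y.2) := by
  rw [extChartAt_prod]
  rfl

theorem extChartAt_cyl (p q : Cyl) :
    extChartAt cylModel p q = (q.1, extChartAt (𝓡 2) p.2 q.2) := by
  rw [extChartAt_prod]
  rfl

theorem extChartAt_cyl_self (p : Cyl) : extChartAt cylModel p p = (p.1, 0) := by
  rw [extChartAt_cyl, extChartAt_sphere_self]

theorem extChartAt_cyl_target (p : Cyl) : (extChartAt cylModel p).target = univ := by
  rw [extChartAt_prod, PartialEquiv.prod_target, extChartAt_sphere_target]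
  have h : (extChartAt 𝓘(ℝ, ℝ) p.1).target = univ := by
    simp only [extChartAt, mfld_simps]
    rfl
  exact (congrArg (· ×ˢ univ) h).trans univ_prod_univ

/-- The charts are onto the model space, so the only restriction in coordinates comes from the
interval. -/
theorem chartDomain_cyl (I : Set ℝ) (p : Cyl) : chartDomain (cyl I) p = I ×ˢ univ := by
  rw [chartDomain, extChartAt_cyl_target]
  ext y
  rw [univ_inter, mem_preimage, extChartAt_cyl_symm]
  simp [cyl]

theorem mfderiv_extChartAt_cyl_symm (p : Cyl) (y v : CylV) :
    mfderiv 𝓘(ℝ, CylV) cylModel (extChartAt cylModel p).symm y v =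
      ((v.1, mfderiv 𝓘(ℝ, EuclideanSpace ℝ (Fin 2)) (𝓡 2) (extChartAt (𝓡 2) p.2).symm y.2 v.2) :
        CylV) := by
  have h1 : HasMFDerivAt 𝓘(ℝ, CylV) 𝓘(ℝ, ℝ) (Prod.fst : CylV → ℝ) y
      (ContinuousLinearMap.fst ℝ ℝ (EuclideanSpace ℝ (Fin 2))) := hasFDerivAt_fst.hasMFDerivAt
  have h2 : HasMFDerivAt 𝓘(ℝ, CylV) 𝓘(ℝ, EuclideanSpace ℝ (Fin 2))
      (Prod.snd : CylV → EuclideanSpace ℝ (Fin 2)) y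
      (ContinuousLinearMap.snd ℝ ℝ (EuclideanSpace ℝ (Fin 2))) := hasFDerivAt_snd.hasMFDerivAt
  have h3 := (mdifferentiableAt_extChartAt_sphere_symm p.2 y.2).hasMFDerivAt.comp y h2
  have h4 := h1.prodMk h3
  have h5 : (extChartAt cylModel p).symm =
      fun y : CylV => (y.1, ((extChartAt (𝓡 2) p.2).symm ∘ Prod.snd) y) :=
    funext fun y => extChartAt_cyl_symm p y
  rw [h5, h4.mfderiv]
  rfl

theorem mvfderiv_extChartAt_cyl_radial (p : Cyl) (y : CylV) (c : ℝ) :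
    mvfderiv cylModel (extChartAt cylModel p) ((extChartAt cylModel p).symm y) ((c, 0) : CylV) =
      ((c, 0) : CylV) := by
  set q := (extChartAt cylModel p).symm y with hq
  have hq2 : q.2 ∈ (extChartAt (𝓡 2) p.2).source := by
    rw [hq, extChartAt_cyl_symm]
    exact (extChartAt (𝓡 2) p.2).map_target (by rw [extChartAt_sphere_target]; trivial)
  have h0 : MDifferentiableAt (𝓡 2) 𝓘(ℝ, EuclideanSpace ℝ (Fin 2)) (extChartAt (𝓡 2) p.2) q.2 :=
    (contMDiffAt_extChartAt' (n := 1) (by simpa using hq2)).mdifferentiableAt one_ne_zero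
  have h1 : HasMFDerivAt cylModel 𝓘(ℝ, ℝ) (Prod.fst : Cyl → ℝ) q _ := hasMFDerivAt_fst q
  have h2 : HasMFDerivAt cylModel (𝓡 2) (Prod.snd : Cyl → S2) q _ := hasMFDerivAt_snd q
  have h3 := h0.hasMFDerivAt.comp q h2
  have h4 : HasMFDerivAt cylModel 𝓘(ℝ, CylV)
      (fun q : Cyl => (q.1, ((extChartAt (𝓡 2) p.2) ∘ Prod.snd) q)) q _ :=
    ⟨h1.1.prodMk h3.1, h1.2.prodMk h3.2⟩
  have h5 : (extChartAt cylModel p : Cyl → CylV) =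
      fun q : Cyl => (q.1, ((extChartAt (𝓡 2) p.2) ∘ Prod.snd) q) :=
    funext fun y => extChartAt_cyl p y
  have h6 := h4.mfderiv
  rw [← h5] at h6
  refine (congrArg (fun A => A ((c, 0) : CylV)) h6).trans ?_
  refine Prod.ext rfl ?_
  exact map_zero (mfderiv (𝓡 2) 𝓘(ℝ, EuclideanSpace ℝ (Fin 2)) (extChartAt (𝓡 2) p.2) q.2)

theorem cylBasis_inl (i : Unit) : cylBasis (Sum.inl i) = ((1, 0) : CylV) := by
  simp [cylBasis, Module.Basis.prod_apply]

theorem cylBasis_inr (i : Fin 2) :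
    cylBasis (Sum.inr i) = ((0, EuclideanSpace.single i 1) : CylV) := by
  simp [cylBasis, Module.Basis.prod_apply]

theorem roundMetric_mfderiv_symm (θ : S2) (w u v : EuclideanSpace ℝ (Fin 2)) :
    roundMetric ((extChartAt (𝓡 2) θ).symm w)
      (mfderiv 𝓘(ℝ, EuclideanSpace ℝ (Fin 2)) (𝓡 2) (extChartAt (𝓡 2) θ).symm w u)
      (mfderiv 𝓘(ℝ, EuclideanSpace ℝ (Fin 2)) (𝓡 2) (extChartAt (𝓡 2) θ).symm w v) =
      16 / (‖w‖ ^ 2 + 4) ^ 2 * inner ℝ u v := by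
  rw [roundMetric, inclDeriv_mfderiv_symm, inclDeriv_mfderiv_symm, inner_fderiv_stereoEmb]

theorem inclDeriv_eq (θ : S2) (v : EuclideanSpace ℝ (Fin 2)) :
    inclDeriv θ v = fderiv ℝ (stereoEmb θ) 0 v := by
  have h := (contMDiff_coe_sphere (E := E3) (n := 2) (m := 1) θ).mdifferentiableAt one_ne_zero
  change mvfderiv (𝓡 2) (fun x : S2 => (x : E3)) θ v = _
  rw [h.mvfderiv]
  simp only [modelWithCornersSelf_coe, range_id, fderivWithin_univ, extChartAt_sphere_self]
  rfl

/-- Tangent vectors at `θ` are expressed in the chart at `θ`, and at its centre the conformal factor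
is `16/4² = 1`. -/
theorem roundMetric_eq (θ : S2) (u v : EuclideanSpace ℝ (Fin 2)) :
    roundMetric θ u v = inner ℝ u v := by
  change inner ℝ (inclDeriv θ u) (inclDeriv θ v) = _
  rw [inclDeriv_eq, inclDeriv_eq, inner_fderiv_stereoEmb]
  norm_num

/-! ### Coordinate curvature and divergence for `ds² + F² g_*`. -/

/-- The matrix `diag(h, u, u)`. -/
def diagMatrix (h u : ℝ) : Matrix (Unit ⊕ Fin 2) (Unit ⊕ Fin 2) ℝ :=
  Matrix.diagonal (Sum.elim (fun _ => h) fun _ => u)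

theorem chartMetric_rotMetric (F : ℝ → ℝ) (p : Cyl) (y : CylV) :
    chartMetric (rotMetric F) p y = diagMatrix 1 (F y.1 ^ 2 * (16 / (‖y.2‖ ^ 2 + 4) ^ 2)) := by
  have key : ∀ u v : CylV, rotMetric F ((extChartAt cylModel p).symm y)
      (mfderiv 𝓘(ℝ, CylV) cylModel (extChartAt cylModel p).symm y u)
      (mfderiv 𝓘(ℝ, CylV) cylModel (extChartAt cylModel p).symm y v) =
      u.1 * v.1 + F y.1 ^ 2 * (16 / (‖y.2‖ ^ 2 + 4) ^ 2 * inner ℝ u.2 v.2) := by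
    intro u v
    rw [mfderiv_extChartAt_cyl_symm, mfderiv_extChartAt_cyl_symm, extChartAt_cyl_symm]
    simp only [rotMetric, warpedMetric]
    erw [roundMetric_mfderiv_symm p.2 y.2 u.2 v.2]
    simp
  ext i j
  rw [chartMetric, key]
  rcases i with i | i <;> rcases j with j | j <;>
    simp [cylBasis_inl, cylBasis_inr, diagMatrix, Matrix.diagonal_apply]
  rw [EuclideanSpace.inner_single_left]
  simp

theorem chartField_radialField (φ : ℝ → ℝ) (p : Cyl) (y : CylV) :
    chartField (radialField φ) p y = Sum.elim (fun _ => φ y.1) fun _ => 0 := by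
  have h : (φ y.1, 0) = φ y.1 • cylBasis (Sum.inl ()) := by
    rw [cylBasis_inl]; ext <;> simp
  have h' : ((extChartAt cylModel p).symm y).1 = y.1 := by rw [extChartAt_cyl_symm]
  ext i
  rw [chartField, radialField, h', mvfderiv_extChartAt_cyl_radial]
  erw [h]
  rw [map_smul, Module.Basis.repr_self]
  rcases i with i | i <;> simp

/-- All coefficients that occur, Christoffel symbols included, are products of a function of `s` and
a function of `w`. This single rule differentiates them, one-sidedly in `s` at boundary points. -/
theorem pderiv_cyl_mul {I : Set ℝ} {y : CylV} (hI : UniqueDiffOn ℝ I) (hy : y.1 ∈ I)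
    {A : ℝ → ℝ} {A' : ℝ} {B : EuclideanSpace ℝ (Fin 2) → ℝ}
    {B' : EuclideanSpace ℝ (Fin 2) →L[ℝ] ℝ}
    (hA : HasDerivWithinAt A A' I y.1) (hB : HasFDerivAt B B' y.2) (k : Unit ⊕ Fin 2) :
    pderiv cylBasis (I ×ˢ univ) k (fun z => A z.1 * B z.2) y =
      Sum.elim (fun _ => A' * B y.2) (fun i => A y.1 * B' (EuclideanSpace.single i 1)) k := by
  have h1 : HasFDerivWithinAt (fun z : CylV => A z.1) _ (I ×ˢ univ) y :=
    HasDerivWithinAt.comp_hasFDerivWithinAt y hA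
      (ContinuousLinearMap.fst ℝ ℝ (EuclideanSpace ℝ (Fin 2))).hasFDerivWithinAt (fun z hz => hz.1)
  have h2 : HasFDerivWithinAt (fun z : CylV => B z.2) _ (I ×ˢ univ) y :=
    (hB.comp y hasFDerivAt_snd).hasFDerivWithinAt
  have hu : UniqueDiffWithinAt ℝ (I ×ˢ (univ : Set (EuclideanSpace ℝ (Fin 2)))) y :=
    (hI.prod uniqueDiffOn_univ) y ⟨hy, trivial⟩
  rw [pderiv, (h1.fun_mul h2).fderivWithin hu]
  rcases k with i | i <;> simp [cylBasis_inl, cylBasis_inr, mul_comm]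

theorem pderiv_congr {ι V : Type} [Fintype ι] [NormedAddCommGroup V]
    [NormedSpace ℝ V] {b : Module.Basis ι ℝ V} {D : Set V} {u v : V → ℝ} {y : V}
    (h : EqOn u v D) (hy : y ∈ D) (k : ι) : pderiv b D k u y = pderiv b D k v y := by
  rw [pderiv, pderiv, fderivWithin_congr h (h hy)]

/-- The conformal factor of the round metric in stereographic coordinates. -/
def stereoFactor (w : EuclideanSpace ℝ (Fin 2)) : ℝ := 16 / (‖w‖ ^ 2 + 4) ^ 2

/-- Half of the logarithmic derivative of `stereoFactor`. -/
def stereoLog (i : Fin 2) (w : EuclideanSpace ℝ (Fin 2)) : ℝ := -2 * w i / (‖w‖ ^ 2 + 4)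

theorem hasFDerivAt_norm_sq_add_four (w : EuclideanSpace ℝ (Fin 2)) :
    HasFDerivAt (fun w : EuclideanSpace ℝ (Fin 2) => ‖w‖ ^ 2 + 4) (2 • innerSL ℝ w) w :=
  (hasStrictFDerivAt_norm_sq w).hasFDerivAt.add_const 4

theorem exists_hasFDerivAt_stereoFactor (w : EuclideanSpace ℝ (Fin 2)) :
    ∃ B' : EuclideanSpace ℝ (Fin 2) →L[ℝ] ℝ, HasFDerivAt stereoFactor B' w ∧
      ∀ i, B' (EuclideanSpace.single i 1) = 2 * stereoFactor w * stereoLog i w := by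
  have hq : ‖w‖ ^ 2 + 4 ≠ 0 := by positivity
  have h2 : HasDerivAt (fun q : ℝ => 16 / q ^ 2) (-32 / (‖w‖ ^ 2 + 4) ^ 3) (‖w‖ ^ 2 + 4) := by
    have := ((hasDerivAt_pow 2 (‖w‖ ^ 2 + 4)).fun_inv (c := fun x : ℝ => x ^ 2) (pow_ne_zero 2 hq)).const_mul 16
    refine (this.congr_deriv ?_)
    field_simp
    ring
  have h3 := h2.comp_hasFDerivAt w (hasFDerivAt_norm_sq_add_four w)
  refine ⟨_, h3, fun i => ?_⟩
  simp [EuclideanSpace.inner_single_right, stereoFactor, stereoLog]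
  field_simp
  ring

theorem exists_hasFDerivAt_stereoLog (i : Fin 2) (w : EuclideanSpace ℝ (Fin 2)) :
    ∃ B' : EuclideanSpace ℝ (Fin 2) →L[ℝ] ℝ, HasFDerivAt (stereoLog i) B' w ∧
      (w = 0 → ∀ j, B' (EuclideanSpace.single j 1) = if i = j then -1 / 2 else 0) := by
  have hq : ‖w‖ ^ 2 + 4 ≠ 0 := by positivity
  have h1 : HasFDerivAt (fun w : EuclideanSpace ℝ (Fin 2) => w i) _ w :=
    (EuclideanSpace.proj (𝕜 := ℝ) i).hasFDerivAt
  have h2 := (h1.const_mul (-2)).mul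
    ((hasDerivAt_inv hq).comp_hasFDerivAt (f := fun w : EuclideanSpace ℝ (Fin 2) => ‖w‖ ^ 2 + 4) w
      (hasFDerivAt_norm_sq_add_four w))
  refine ⟨_, h2, ?_⟩
  rintro rfl j
  simp
  split_ifs <;> norm_num

theorem stereoFactor_pos (w : EuclideanSpace ℝ (Fin 2)) : 0 < stereoFactor w := by
  unfold stereoFactor; positivity

theorem stereoFactor_zero : stereoFactor 0 = 1 := by norm_num [stereoFactor]

theorem stereoLog_zero (i : Fin 2) : stereoLog i 0 = 0 := by simp [stereoLog]

theorem diagMatrix_inv {u : ℝ} (hu : u ≠ 0) : (diagMatrix 1 u)⁻¹ = diagMatrix 1 u⁻¹ := by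
  refine Matrix.inv_eq_right_inv ?_
  rw [diagMatrix, diagMatrix, Matrix.diagonal_mul_diagonal, ← Matrix.diagonal_one]
  congr 1
  ext i
  rcases i with i | i <;> simp [hu]

theorem chartMetric_rotMetric' (F : ℝ → ℝ) (p : Cyl) :
    chartMetric (rotMetric F) p = fun y => diagMatrix 1 (F y.1 ^ 2 * stereoFactor y.2) :=
  funext fun y => chartMetric_rotMetric F p y

section

variable {I : Set ℝ} {F F₁ F₂ : ℝ → ℝ}

/-- The partial derivatives of the coefficients of `ds² + F² g_*`. -/
def metricPartial (F F₁ : ℝ → ℝ) (y : CylV) : (k i j : Unit ⊕ Fin 2) → ℝ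
  | .inl _, .inr i, .inr j => if i = j then 2 * F y.1 * F₁ y.1 * stereoFactor y.2 else 0
  | .inr k, .inr i, .inr j =>
    if i = j then F y.1 ^ 2 * (2 * stereoFactor y.2 * stereoLog k y.2) else 0
  | _, _, _ => 0

theorem pderiv_metric (hI : UniqueDiffOn ℝ I)
    (h₁ : ∀ s ∈ I, HasDerivWithinAt F (F₁ s) I s) {y : CylV} (hy : y.1 ∈ I) (k i j : Unit ⊕ Fin 2) :
    pderiv cylBasis (I ×ˢ univ)
      k (fun z => diagMatrix 1 (F z.1 ^ 2 * stereoFactor z.2) i j) y =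
      metricPartial F F₁ y k i j := by
  have hc : ∀ c : ℝ, pderiv cylBasis (I ×ˢ univ) k (fun _ => c) y = 0 := fun c => by
    simp [pderiv]
  rcases i with i | i <;> rcases j with j | j
  · simpa [diagMatrix, metricPartial] using hc 1
  · simpa [diagMatrix, metricPartial] using hc 0
  · simpa [diagMatrix, metricPartial] using hc 0
  · obtain ⟨B', hB, hB'⟩ := exists_hasFDerivAt_stereoFactor y.2
    have := pderiv_cyl_mul hI hy ((h₁ y.1 hy).fun_pow 2) hB k
    by_cases hij : i = j
    · subst hij
      simp only [diagMatrix, Matrix.diagonal_apply_eq, Sum.elim_inr, this]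
      rcases k with k | k <;> simp [metricPartial, hB']
    · have h : ∀ z : CylV, diagMatrix 1 (F z.1 ^ 2 * stereoFactor z.2) (.inr i) (.inr j) = 0 :=
        fun z => Matrix.diagonal_apply_ne _ (by simpa using hij)
      simp only [h, hc]
      rcases k with k | k <;> simp [metricPartial, hij]

/-- The factor depending on `s` of the Christoffel symbols of `ds² + F² g_*`. -/
def christoffelRadial (F F₁ : ℝ → ℝ) : (k i j : Unit ⊕ Fin 2) → ℝ → ℝ
  | .inl _, .inr _, .inr _ => fun s => -(F s * F₁ s)
  | .inr _, .inl _, .inr _ => fun s => F₁ s / F s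
  | .inr _, .inr _, .inl _ => fun s => F₁ s / F s
  | .inr _, .inr _, .inr _ => fun _ => 1
  | _, _, _ => fun _ => 0

/-- The factor depending on the spherical coordinates of the Christoffel symbols of
`ds² + F² g_*`. -/
def christoffelSphere : (k i j : Unit ⊕ Fin 2) → EuclideanSpace ℝ (Fin 2) → ℝ
  | .inl _, .inr i, .inr j => fun w => (if i = j then 1 else 0) * stereoFactor w
  | .inr k, .inl _, .inr j => fun _ => if k = j then 1 else 0
  | .inr k, .inr j, .inl _ => fun _ => if k = j then 1 else 0
  | .inr k, .inr i, .inr j => fun w => (if k = j then 1 else 0) * stereoLog i w +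
      (if k = i then 1 else 0) * stereoLog j w - (if i = j then 1 else 0) * stereoLog k w
  | _, _, _ => fun _ => 0

/-- The formula is needed on the whole coordinate domain, and not only at the centre, because the
Ricci curvature differentiates it. The factored form makes `pderiv_cyl_mul` applicable a second
time. -/
theorem christoffel_rot (hI : UniqueDiffOn ℝ I) (hF : ∀ s ∈ I, 0 < F s)
    (h₁ : ∀ s ∈ I, HasDerivWithinAt F (F₁ s) I s) {y : CylV} (hy : y.1 ∈ I) (k i j : Unit ⊕ Fin 2) :
    christoffel cylBasis (I ×ˢ univ)
      (fun z => diagMatrix 1 (F z.1 ^ 2 * stereoFactor z.2)) k i j y =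
      christoffelRadial F F₁ k i j y.1 * christoffelSphere k i j y.2 := by
  have hF' := hF y.1 hy
  have hs := stereoFactor_pos y.2
  simp only [christoffel, pderiv_metric hI h₁ hy]
  rw [diagMatrix_inv (by positivity)]
  rcases k with k | k <;> rcases i with i | i <;> rcases j with j | j <;>
    simp [diagMatrix, Matrix.diagonal_apply, metricPartial, christoffelRadial, christoffelSphere,
      ite_mul, mul_ite, -Fin.sum_univ_two]
  · split_ifs <;> ring
  · by_cases h : k = j
    · subst h; simp; field_simp
    · simp [h, Ne.symm h]
  · by_cases h : k = i
    · subst h; simp; field_simp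
    · simp [h, Ne.symm h]
  · split_ifs <;> field_simp <;> grind


/-- The partial derivatives at `w = 0` of the Christoffel symbols of `ds² + F² g_*`. -/
def christoffelPartial (F F₁ F₂ : ℝ → ℝ) (s : ℝ) : (l k i j : Unit ⊕ Fin 2) → ℝ
  | .inl _, .inl _, .inr i, .inr j => if i = j then -(F₁ s ^ 2 + F s * F₂ s) else 0
  | .inl _, .inr k, .inl _, .inr j => if k = j then (F₂ s * F s - F₁ s ^ 2) / F s ^ 2 else 0
  | .inl _, .inr k, .inr i, .inl _ => if k = i then (F₂ s * F s - F₁ s ^ 2) / F s ^ 2 else 0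
  | .inr l, .inr k, .inr i, .inr j => -1 / 2 * ((if k = j ∧ l = i then 1 else 0) +
      (if k = i ∧ l = j then 1 else 0) - if i = j ∧ k = l then 1 else 0)
  | _, _, _, _ => 0

theorem pderiv_christoffel_rot (hI : UniqueDiffOn ℝ I) (hF : ∀ s ∈ I, 0 < F s)
    (h₁ : ∀ s ∈ I, HasDerivWithinAt F (F₁ s) I s) {s : ℝ}
    (h₂ : HasDerivWithinAt F₁ (F₂ s) I s) (hs : s ∈ I) (l k i j : Unit ⊕ Fin 2) :
    pderiv cylBasis (I ×ˢ univ) l (christoffel cylBasis (I ×ˢ univ)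
      (fun z => diagMatrix 1 (F z.1 ^ 2 * stereoFactor z.2)) k i j) (s, 0) =
      christoffelPartial F F₁ F₂ s l k i j := by
  have hF' := (hF s hs).ne'
  rw [pderiv_congr (v := fun z : CylV => christoffelRadial F F₁ k i j z.1 *
    christoffelSphere k i j z.2) (fun z hz => christoffel_rot hI hF h₁ hz.1 k i j) (mem_prod.2 ⟨hs, mem_univ _⟩)]
  have hc : ∀ c : ℝ, HasFDerivAt (fun _ : EuclideanSpace ℝ (Fin 2) => c)
      (0 : EuclideanSpace ℝ (Fin 2) →L[ℝ] ℝ) 0 := fun c => hasFDerivAt_const c _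
  have hc' : ∀ c : ℝ, HasDerivWithinAt (fun _ => c) 0 I s := fun c => hasDerivWithinAt_const _ _ _
  obtain ⟨B', hB, hB'⟩ := exists_hasFDerivAt_stereoFactor 0
  choose D' hD hD' using fun i => exists_hasFDerivAt_stereoLog i 0
  have hq := (h₁ s hs)
  have key := fun A A' B B' hA hB =>
    pderiv_cyl_mul (I := I) (y := (s, 0)) (A := A) (A' := A') (B := B) (B' := B') hI hs hA hB l
  rcases k with k | k <;> rcases i with i | i <;> rcases j with j | j
  · refine (key _ _ _ _ (hc' 0) (hc 0)).trans ?_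
    rcases l with l | l <;> simp [christoffelPartial]
  · refine (key _ _ _ _ (hc' 0) (hc 0)).trans ?_
    rcases l with l | l <;> simp [christoffelPartial]
  · refine (key _ _ _ _ (hc' 0) (hc 0)).trans ?_
    rcases l with l | l <;> simp [christoffelPartial]
  · refine (key _ _ _ _ (hq.mul h₂).neg (hB.const_mul (if i = j then 1 else 0))).trans ?_
    rcases l with l | l
    · by_cases h : i = j <;> simp [christoffelPartial, stereoFactor_zero, h]
      ring
    · by_cases h : i = j <;> simp [christoffelPartial, hB', stereoLog_zero, h]
  · refine (key _ _ _ _ (hc' 0) (hc 0)).trans ?_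
    rcases l with l | l <;> simp [christoffelPartial]
  · refine (key _ _ _ _ (h₂.div hq hF') (hc (if k = j then 1 else 0))).trans ?_
    rcases l with l | l
    · by_cases h : k = j <;> simp [christoffelPartial, h]
      ring
    · simp [christoffelPartial]
  · refine (key _ _ _ _ (h₂.div hq hF') (hc (if k = i then 1 else 0))).trans ?_
    rcases l with l | l
    · by_cases h : k = i <;> simp [christoffelPartial, h]
      ring
    · simp [christoffelPartial]
  · refine (key _ _ _ _ (hc' 1) ((((hD i).const_mul (if k = j then 1 else 0)).add
      ((hD j).const_mul (if k = i then 1 else 0))).sub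
      ((hD k).const_mul (if i = j then 1 else 0)))).trans ?_
    rcases l with l | l
    · simp [christoffelPartial]
    · simp only [christoffelPartial, Sum.elim_inr, _root_.sub_apply,
        _root_.add_apply, _root_.smul_apply, hD', smul_eq_mul]
      clear key hc hc' hB hB' hD hD' h₁ h₂ hI hF
      grind

/-- At `w = 0` the logarithmic derivatives of the conformal factor vanish, so the sphere enters only
through their derivatives `-1/2`; these produce the term `1`, the curvature of the unit sphere. -/
theorem coordScalar_rot (hI : UniqueDiffOn ℝ I) (hF : ∀ s ∈ I, 0 < F s)
    (h₁ : ∀ s ∈ I, HasDerivWithinAt F (F₁ s) I s) {s : ℝ}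
    (h₂ : HasDerivWithinAt F₁ (F₂ s) I s) (hs : s ∈ I) :
    coordScalar cylBasis (I ×ˢ univ) (fun z => diagMatrix 1 (F z.1 ^ 2 * stereoFactor z.2)) (s, 0) =
      2 / F s ^ 2 * (1 - F₁ s ^ 2 - 2 * F s * F₂ s) := by
  have hF' := (hF s hs).ne'
  have hy : ((s, 0) : CylV).1 ∈ I := hs
  simp only [coordScalar, coordRicci, pderiv_christoffel_rot hI hF h₁ h₂ hs,
    christoffel_rot hI hF h₁ hy]
  rw [diagMatrix_inv (by rw [stereoFactor_zero]; positivity)]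
  simp [diagMatrix, Matrix.diagonal_apply, christoffelPartial, christoffelRadial,
    christoffelSphere, stereoFactor_zero, stereoLog_zero]
  field_simp
  ring

theorem coordNormal_rot (hI : UniqueDiffOn ℝ I) (hF : ∀ s ∈ I, 0 < F s) {y : CylV}
    (hy : y.1 ∈ I) :
    coordNormal cylBasis (I ×ˢ univ) (fun z => diagMatrix 1 (F z.1 ^ 2 * stereoFactor z.2))
      (fun z => z.1) y = Sum.elim (fun _ => 1) fun _ => 0 := by
  have h : ∀ k, pderiv cylBasis (I ×ˢ univ) k (fun z : CylV => z.1) y =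
      Sum.elim (fun _ => 1) (fun _ => 0) k := fun k => by
    have := pderiv_cyl_mul hI hy (hasDerivWithinAt_id y.1 I) (hasFDerivAt_const (1 : ℝ) y.2) k
    simpa using this
  have hF' := hF y.1 hy
  have hs := stereoFactor_pos y.2
  ext i
  simp only [coordNormal, h]
  rw [diagMatrix_inv (by positivity)]
  rcases i with i | i <;> simp [diagMatrix]

theorem coordDiv_rot (hI : UniqueDiffOn ℝ I) (hF : ∀ s ∈ I, 0 < F s)
    (h₁ : ∀ s ∈ I, HasDerivWithinAt F (F₁ s) I s) {s : ℝ} (hs : s ∈ I) {φ : ℝ → ℝ} {φ' : ℝ}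
    (hφ : HasDerivWithinAt φ φ' I s) {X : CylV → Unit ⊕ Fin 2 → ℝ}
    (hX : ∀ y : CylV, y.1 ∈ I → X y = Sum.elim (fun _ => φ y.1) fun _ => 0) :
    coordDiv cylBasis (I ×ˢ univ) (fun z => diagMatrix 1 (F z.1 ^ 2 * stereoFactor z.2)) X (s, 0) =
      φ' + 2 * F₁ s / F s * φ s := by
  have hy : ((s, 0) : CylV).1 ∈ I := hs
  have h : ∀ k, pderiv cylBasis (I ×ˢ univ) k (fun z : CylV => X z k) (s, 0) =
      Sum.elim (fun _ => φ') (fun _ => 0) k := fun k => by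
    have := pderiv_cyl_mul hI hy hφ (hasFDerivAt_const (1 : ℝ) (0 : EuclideanSpace ℝ (Fin 2))) k
    rw [pderiv_congr (v := fun z : CylV => Sum.elim (fun _ => φ z.1) (fun _ => 0) k)
      (fun z hz => congrFun (hX z hz.1) k) (mem_prod.2 ⟨hs, mem_univ _⟩)]
    rcases k with k | k
    · simpa using this
    · simp [pderiv]
  simp only [coordDiv, h, christoffel_rot hI hF h₁ hy, hX _ hy]
  simp [christoffelRadial, christoffelSphere]
  ring

end

/-! ### Scalar curvature, mean curvature, charge and Hawking mass of a rotationally symmetric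
metric. -/

section

variable {I : Set ℝ} {F F₁ F₂ : ℝ → ℝ} {p : Cyl}

theorem scalarCurvature_rotMetric (hI : UniqueDiffOn ℝ I) (hF : ∀ s ∈ I, 0 < F s)
    (h₁ : ∀ s ∈ I, HasDerivWithinAt F (F₁ s) I s) (h₂ : HasDerivWithinAt F₁ (F₂ p.1) I p.1)
    (hp : p ∈ cyl I) :
    scalarCurvature (cyl I) (rotMetric F) p =
      2 / F p.1 ^ 2 * (1 - F₁ p.1 ^ 2 - 2 * F p.1 * F₂ p.1) := by
  rw [scalarCurvature, chartDomain_cyl, chartMetric_rotMetric', extChartAt_cyl_self]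
  exact coordScalar_rot hI hF h₁ h₂ hp.1

theorem divergence_radialField (hI : UniqueDiffOn ℝ I) (hF : ∀ s ∈ I, 0 < F s)
    (h₁ : ∀ s ∈ I, HasDerivWithinAt F (F₁ s) I s) {φ : ℝ → ℝ} {φ' : ℝ}
    (hφ : HasDerivWithinAt φ φ' I p.1) (hp : p ∈ cyl I) :
    divergence (cyl I) (rotMetric F) (radialField φ) p = φ' + 2 * F₁ p.1 / F p.1 * φ p.1 := by
  rw [divergence, chartDomain_cyl, chartMetric_rotMetric', extChartAt_cyl_self]
  exact coordDiv_rot hI hF h₁ hp.1 hφ fun y _ => chartField_radialField φ p y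

theorem chartNormal_rotMetric (hI : UniqueDiffOn ℝ I) (hF : ∀ s ∈ I, 0 < F s) {y : CylV}
    (hy : y.1 ∈ I) :
    chartNormal (cyl I) (rotMetric F) p y = Sum.elim (fun _ => 1) fun _ => 0 := by
  have h : (fun y : CylV => ((extChartAt cylModel p).symm y).1) = fun y => y.1 :=
    funext fun y => by rw [extChartAt_cyl_symm]
  rw [chartNormal, chartDomain_cyl, chartMetric_rotMetric', h]
  exact coordNormal_rot hI hF hy

theorem meanCurvature_rotMetric (hI : UniqueDiffOn ℝ I) (hF : ∀ s ∈ I, 0 < F s)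
    (h₁ : ∀ s ∈ I, HasDerivWithinAt F (F₁ s) I s) (hp : p ∈ cyl I) :
    meanCurvature (cyl I) (rotMetric F) p = 2 * F₁ p.1 / F p.1 := by
  rw [meanCurvature, chartDomain_cyl, chartMetric_rotMetric', extChartAt_cyl_self]
  refine (coordDiv_rot hI hF h₁ hp.1 (hasDerivWithinAt_const p.1 I (1 : ℝ))
    fun y hy => chartNormal_rotMetric hI hF hy).trans ?_
  ring

theorem normalComponent_radialField (hI : UniqueDiffOn ℝ I) (hF : ∀ s ∈ I, 0 < F s)
    (hp : p ∈ cyl I) (φ : ℝ → ℝ) :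
    normalComponent (cyl I) (rotMetric F) (radialField φ) p = φ p.1 := by
  have hy : ((p.1, 0) : CylV).1 ∈ I := hp.1
  simp only [normalComponent, extChartAt_cyl_self, chartNormal_rotMetric hI hF hy,
    chartField_radialField, chartMetric_rotMetric']
  simp [diagMatrix]

theorem areaDensity_rotMetric (F : ℝ → ℝ) (s : ℝ) (θ : S2) :
    areaDensity (rotMetric F) s θ = F s ^ 2 := by
  have h : ∀ i j : Fin 2, roundMetric θ (EuclideanSpace.basisFun (Fin 2) ℝ i)
      (EuclideanSpace.basisFun (Fin 2) ℝ j) = if i = j then 1 else 0 := fun i j => by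
    rw [roundMetric_eq]
    simp [EuclideanSpace.inner_single_left]
  rw [areaDensity]
  simp only [rotMetric, warpedMetric, h, Matrix.det_fin_two, Matrix.of_apply]
  simp
  exact Real.sqrt_mul_self (by positivity)

theorem sphereIntegral_rotMetric (F : ℝ → ℝ) (s c : ℝ) {u : Cyl → ℝ}
    (hu : ∀ p ∈ coordSphere s, u p = c) :
    sphereIntegral (rotMetric F) s u = 4 * Real.pi * F s ^ 2 * c := by
  have h : ∀ θ : S2, u (s, θ) * areaDensity (rotMetric F) s θ = c * F s ^ 2 := fun θ => by
    rw [areaDensity_rotMetric, hu (s, θ) (mem_prod.2 ⟨mem_singleton s, mem_univ _⟩)]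
  simp only [sphereIntegral, h]
  rw [integral_const, Measure.toSphere_real_apply_univ, measureReal_def,
    EuclideanSpace.volume_ball_fin_three]
  simp
  rw [ENNReal.toReal_ofReal (by positivity)]
  ring

theorem chargedHawkingMass_rotMetric (hI : UniqueDiffOn ℝ I) (hF : ∀ s ∈ I, 0 < F s)
    (h₁ : ∀ s ∈ I, HasDerivWithinAt F (F₁ s) I s) {s : ℝ} (hs : s ∈ I) (Q : ℝ) :
    chargedHawkingMass (cyl I) (rotMetric F) (electricField Q F) s =
      F s / 2 * (1 - F₁ s ^ 2 + Q ^ 2 / F s ^ 2) := by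
  have hF' := hF s hs
  have hsub : ∀ p ∈ coordSphere s, p ∈ cyl I ∧ p.1 = s := fun p hp => by
    obtain ⟨h, -⟩ := hp
    rw [mem_singleton_iff] at h
    exact ⟨⟨h ▸ hs, trivial⟩, h⟩
  have hA : sphereArea (rotMetric F) s = 4 * Real.pi * F s ^ 2 := by
    rw [sphereArea, sphereIntegral_rotMetric F s 1 fun _ _ => rfl, mul_one]
  have hQ : sphereCharge (cyl I) (rotMetric F) (electricField Q F) s = Q := by
    rw [sphereCharge, sphereIntegral_rotMetric F s (Q / F s ^ 2)]
    · field_simp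
    · intro p hp
      rw [electricField, normalComponent_radialField hI hF (hsub p hp).1, (hsub p hp).2]
  rw [chargedHawkingMass, hA, hQ, sphereIntegral_rotMetric F s ((2 * F₁ s / F s) ^ 2)]
  · have : Real.sqrt (4 * Real.pi * F s ^ 2 / (16 * Real.pi)) = F s / 2 := by
      rw [Real.sqrt_eq_iff_mul_self_eq (by positivity) (by positivity)]
      field_simp
      norm_num
    rw [this]
    field_simp
    ring
  · intro p hp
    rw [meanCurvature_rotMetric hI hF h₁ (hsub p hp).1, (hsub p hp).2]

end

/-! ### Reparametrizations of the line and monotone transitions. -/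

open Filter Topology in
/-- If `h` is smooth and positive, equal to `1` to the left of `c` and bounded below on the right,
its primitive that is the identity on the left is a diffeomorphism of the line. -/
theorem exists_diffeo_of_deriv {h : ℝ → ℝ} (hh : ContDiff ℝ ∞ h) (hpos : ∀ t, 0 < h t) {c T : ℝ}
    (hc : ∀ t < c, h t = 1) (hT : ∀ t ≥ T, 1 / 2 ≤ h t) :
    ∃ S : ℝ ≃ₜ ℝ, StrictMono S ∧ ContDiff ℝ ∞ S ∧ ContDiff ℝ ∞ S.symm ∧
      (∀ t, HasDerivAt S (h t) t) ∧ ∀ t ≤ c, S t = t := by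
  let S : ℝ → ℝ := fun t => c + ∫ u in c..t, h u
  have hd : ∀ t, HasDerivAt S (h t) t := fun t =>
    (intervalIntegral.integral_hasDerivAt_right (hh.continuous.intervalIntegrable _ _)
      hh.continuous.aestronglyMeasurable.stronglyMeasurableAtFilter
      hh.continuous.continuousAt).const_add c
  have hderiv : deriv S = h := funext fun t => (hd t).deriv
  have hmono : StrictMono S := strictMono_of_deriv_pos fun t => by rw [hderiv]; exact hpos t
  have hdiff : Differentiable ℝ S := fun t => (hd t).differentiableAt
  have hS : ContDiff ℝ ∞ S := contDiff_infty_iff_deriv.2 ⟨hdiff, hderiv ▸ hh⟩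
  have hleft : ∀ t ≤ c, S t = t := fun t ht => by
    have : ∫ u in c..t, h u = ∫ u in c..t, (1 : ℝ) := by
      rw [intervalIntegral.integral_symm, intervalIntegral.integral_symm t]
      congr 1
      refine intervalIntegral.integral_congr_ae ?_
      -- The hypothesis gives `h = 1` only strictly to the left of `c`; the endpoint is a null set.
      have : ∀ᵐ u : ℝ, u ≠ c := by simp [ae_iff]
      filter_upwards [this] with u hu hu'
      rw [uIoc_of_le ht] at hu'
      exact hc u (lt_of_le_of_ne hu'.2 hu)
    simp [S, this]
  have hbot : Tendsto S atBot atBot := by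
    refine (tendsto_congr' ?_).2 tendsto_id
    filter_upwards [eventually_le_atBot c] with t ht using hleft t ht
  -- The lower bound on `h` makes `S(t) - t/2` nondecreasing beyond `T`, which gives surjectivity.
  have htop : Tendsto S atTop atTop := by
    have hm : MonotoneOn (fun t => S t - t / 2) (Ici T) := by
      have hd' : ∀ t, HasDerivAt (fun t => S t - t / 2) (h t - 1 / 2) t := fun t =>
        (hd t).sub ((hasDerivAt_id t).div_const 2)
      refine monotoneOn_of_deriv_nonneg (convex_Ici T)
        (fun t _ => (hd' t).continuousAt.continuousWithinAt)
        (fun t _ => (hd' t).differentiableAt.differentiableWithinAt) fun t ht => ?_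
      rw [interior_Ici] at ht
      rw [(hd' t).deriv]
      linarith [hT t (le_of_lt ht)]
    have h2 : Tendsto (fun t : ℝ => S T - T / 2 + t / 2) atTop atTop :=
      tendsto_atTop_add_const_left _ _ (tendsto_id.atTop_div_const (by norm_num))
    refine tendsto_atTop_mono' _ ?_ h2
    filter_upwards [eventually_ge_atTop T] with t ht
    have := hm self_mem_Ici ht ht
    simp only at this
    linarith
  let e : ℝ ≃ₜ ℝ := (hmono.orderIsoOfSurjective S
    (hS.continuous.surjective htop hbot)).toHomeomorph
  have he : (e : ℝ → ℝ) = S := rfl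
  exact ⟨e, hmono, hS, e.contDiff_symm_deriv (f' := h) (fun t => (hpos t).ne') hd hS, hd, hleft⟩

/-- The smooth monotone step from `0` to `1` on `[α, β]`. -/
def smoothStep (α β t : ℝ) : ℝ := Real.smoothTransition ((t - α) / (β - α))

/-- The transition from `u` to `v` on `[α, β]`. -/
def blend (α β : ℝ) (u v : ℝ → ℝ) (t : ℝ) : ℝ :=
  (1 - smoothStep α β t) * u t + smoothStep α β t * v t

section

variable {α β t : ℝ} {u v : ℝ → ℝ}

theorem contDiff_smoothStep : ContDiff ℝ ∞ (smoothStep α β) :=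
  Real.smoothTransition.contDiff.comp ((contDiff_id.sub contDiff_const).div_const _)

theorem smoothStep_of_le (h : α < β) (ht : t ≤ α) : smoothStep α β t = 0 :=
  Real.smoothTransition.zero_of_nonpos (div_nonpos_of_nonpos_of_nonneg (by linarith) (by linarith))

theorem smoothStep_of_ge (h : α < β) (ht : β ≤ t) : smoothStep α β t = 1 :=
  Real.smoothTransition.one_of_one_le ((one_le_div (by linarith)).2 (by linarith))

theorem smoothStep_nonneg : 0 ≤ smoothStep α β t := Real.smoothTransition.nonneg _

theorem smoothStep_le_one : smoothStep α β t ≤ 1 := Real.smoothTransition.le_one _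

theorem monotone_smoothStep (h : α < β) : Monotone (smoothStep α β) := fun x y hxy =>
  Real.smoothTransition.monotone (div_le_div_of_nonneg_right (by linarith) (by linarith))

theorem blend_of_le (h : α < β) (ht : t ≤ α) : blend α β u v t = u t := by
  simp [blend, smoothStep_of_le h ht]

theorem blend_of_ge (h : α < β) (ht : β ≤ t) : blend α β u v t = v t := by
  simp [blend, smoothStep_of_ge h ht]

theorem blend_eventuallyEq (h : α < β) (ht : β < t) : blend α β u v =ᶠ[nhds t] v := by
  filter_upwards [lt_mem_nhds ht] with x hx using blend_of_ge h hx.le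

/-- Nothing is asked of `u` beyond `β`, where only `v` is left. This matters because the given
radius function is controlled only before `b`. -/
theorem contDiffAt_blend (h : α < β) (hu : t ≤ β → ContDiffAt ℝ ∞ u t)
    (hv : ContDiffAt ℝ ∞ v t) : ContDiffAt ℝ ∞ (blend α β u v) t := by
  rcases le_or_gt t β with ht | ht
  · have hs := (contDiff_smoothStep (α := α) (β := β)).contDiffAt (x := t)
    exact ((contDiffAt_const.sub hs).mul (hu ht)).add (hs.mul hv)
  · exact hv.congr_of_eventuallyEq (blend_eventuallyEq h ht)

theorem blend_le (h : α < β) {B : ℝ} (hu : t < β → u t ≤ B) (hv : v t ≤ B) :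
    blend α β u v t ≤ B := by
  rcases lt_or_ge t β with ht | ht
  · have h0 := smoothStep_nonneg (α := α) (β := β) (t := t)
    have h1 := smoothStep_le_one (α := α) (β := β) (t := t)
    have := mul_le_mul_of_nonneg_left (hu ht) (sub_nonneg.2 h1)
    have := mul_le_mul_of_nonneg_left hv h0
    rw [blend]
    linarith
  · rwa [blend_of_ge h ht]

/-- With `σ` the step, the derivative is `(1 - σ)u' + σv' + σ'(v - u)`. The last term is nonnegative
when the transition goes up to a larger function, so lower bounds on slopes persist. -/
theorem exists_hasDerivAt_blend (h : α < β) {l v' : ℝ}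
    (hu : t ≤ β → ∃ u', HasDerivAt u u' t ∧ l ≤ u') (hv : HasDerivAt v v' t) (hl : l ≤ v')
    (huv : α ≤ t → t ≤ β → u t ≤ v t) :
    ∃ d, HasDerivAt (blend α β u v) d t ∧ l ≤ d := by
  rcases le_or_gt t β with ht | ht
  · obtain ⟨u', hu', hlu⟩ := hu ht
    have hs : HasDerivAt (smoothStep α β) (deriv (smoothStep α β) t) t :=
      (contDiff_smoothStep.differentiable (by simp) t).hasDerivAt
    refine ⟨_, ((hs.const_sub 1).mul hu').add (hs.mul hv), ?_⟩
    have h0 := smoothStep_nonneg (α := α) (β := β) (t := t)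
    have h1 := smoothStep_le_one (α := α) (β := β) (t := t)
    have h2 : 0 ≤ deriv (smoothStep α β) t * (v t - u t) := by
      rcases le_or_gt α t with hα | hα
      · exact mul_nonneg (monotone_smoothStep h).deriv_nonneg (sub_nonneg.2 (huv hα ht))
      · have : smoothStep α β =ᶠ[nhds t] fun _ => 0 := by
          filter_upwards [gt_mem_nhds hα] with x hx using smoothStep_of_le h hx.le
        rw [this.deriv_eq]
        simp
    have h3 := mul_le_mul_of_nonneg_left hlu (sub_nonneg.2 h1)
    have h4 := mul_le_mul_of_nonneg_left hl h0
    linarith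
  · exact ⟨v', hv.congr_of_eventuallyEq (blend_eventuallyEq h ht), hl⟩

end

/-! ### Mass function and construction of the radius function. -/

/-- The charged Hawking mass of a sphere of radius `r` in `ds² + r(s)² g_*`, `d = r'(s)`. -/
def radialMass (Q r d : ℝ) : ℝ := r / 2 * (1 - d ^ 2 + Q ^ 2 / r ^ 2)

/-- The second factor is `(F²/2)(R - 2|E|²)`: for increasing `F`, the energy condition is
monotonicity of the mass. -/
theorem hasDerivAt_radialMass {Q s F₂ : ℝ} {F F₁ : ℝ → ℝ} (h₁ : HasDerivAt F (F₁ s) s)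
    (h₂ : HasDerivAt F₁ F₂ s) (hF : F s ≠ 0) :
    HasDerivAt (fun s => radialMass Q (F s) (F₁ s))
      (F₁ s / 2 * (1 - F₁ s ^ 2 - 2 * F s * F₂ - Q ^ 2 / F s ^ 2)) s := by
  have := (h₁.div_const 2).mul (((h₂.fun_pow 2).const_sub 1).add
    ((hasDerivAt_const s (Q ^ 2)).fun_div (h₁.fun_pow 2) (pow_ne_zero 2 hF)))
  refine this.congr_deriv ?_
  simp
  field_simp
  ring

/-- Interpolation, in an auxiliary radial parameter, between a given area radius and mass function
and those of a Reissner–Nordström space. -/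
theorem exists_radius_mass {s₀ b Q c m : ℝ} {f : ℝ → ℝ} (hsb : s₀ < b)
    (hf : ∀ s ∈ Ioo s₀ b, ContDiffAt ℝ ∞ f s) (hd : ∀ s ∈ Ioo s₀ b, 0 < deriv f s)
    (hfQ : ∀ s ∈ Ioo s₀ b, |Q| < f s)
    (hdec : ∀ s ∈ Ioo s₀ b, 0 ≤ 1 - deriv f s ^ 2 - 2 * f s * deriv (deriv f) s - Q ^ 2 / f s ^ 2)
    (hM : ∀ s ∈ Ioo s₀ b, radialMass Q (f s) (deriv f s) < c)
    (hc : ∀ s ∈ Ioo s₀ b, 2 * c * f s < f s ^ 2 + Q ^ 2) (hQc : |Q| < c) (hcm : c < m) :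
    ∃ (ρ μ : ℝ → ℝ) (κ t₁ t₄ : ℝ), s₀ < t₁ ∧ t₁ < b ∧ t₁ < t₄ ∧ 2 * m < t₄ + κ ∧
      (∀ t ≤ t₁, ρ t = f t) ∧
      (∀ t ∈ Ioo s₀ t₁, μ t = radialMass Q (f t) (deriv f t)) ∧
      (∀ t > s₀, ContDiffAt ℝ ∞ ρ t ∧ ContDiffAt ℝ ∞ μ t ∧ 0 < deriv ρ t ∧ 0 ≤ deriv μ t ∧
        |Q| < ρ t ∧ 2 * μ t * ρ t < ρ t ^ 2 + Q ^ 2) ∧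
      ∀ t ≥ t₄, ρ t = t + κ ∧ μ t = m := by
  obtain ⟨t₁, ht₁, ht₁b⟩ := exists_between hsb
  obtain ⟨t₂, ht₂, ht₂b⟩ := exists_between ht₁b
  have hQ0 := abs_nonneg Q
  have hm : 0 < m := by linarith
  have hfm : StrictMonoOn f (Ioo s₀ b) := by
    refine strictMonoOn_of_deriv_pos (convex_Ioo _ _)
      (fun s hs => (hf s hs).continuousAt.continuousWithinAt) fun s hs => ?_
    rw [interior_Ioo] at hs
    exact hd s hs
  have hm₁ : t₁ ∈ Ioo s₀ b := ⟨ht₁, ht₁b⟩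
  have hm₂ : t₂ ∈ Ioo s₀ b := ⟨ht₁.trans ht₂, ht₂b⟩
  -- This shift gives `t + κ ≥ f t₂ ≥ f t` on `[t₁, t₂]`, so the transition is upwards and `ρ` stays
  -- increasing.
  set κ := f t₂ - t₁ with hκ
  set ρ := blend t₁ t₂ f fun t => t + κ with hρ
  -- From `t₃` on the radius exceeds `2m`, so any mass at most `m` keeps `V` positive.
  obtain ⟨t₃, ht₃⟩ := exists_gt (max t₂ (2 * m - κ))
  have ht₃₂ : t₂ < t₃ := (le_max_left _ _).trans_lt ht₃
  have ht₃m : 2 * m < t₃ + κ := by linarith [(le_max_right t₂ (2 * m - κ)).trans_lt ht₃]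
  set M : ℝ → ℝ := fun t => radialMass Q (f t) (deriv f t) with hMdef
  set μ₁ := blend t₁ t₂ M fun _ => c with hμ₁
  set μ := blend t₃ (t₃ + 1) μ₁ fun _ => m with hμ
  have h₃ : t₃ < t₃ + 1 := by linarith
  have hmem : ∀ t > s₀, t ≤ t₂ → t ∈ Ioo s₀ b := fun t ht h => ⟨ht, h.trans_lt ht₂b⟩
  have hρ_of_le : ∀ t ≤ t₁, ρ t = f t := fun t ht => blend_of_le ht₂ ht
  have hρ_of_ge : ∀ t ≥ t₂, ρ t = t + κ := fun t ht => blend_of_ge ht₂ ht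
  have hμ₁_of_ge : ∀ t ≥ t₂, μ₁ t = c := fun t ht => blend_of_ge ht₂ ht
  have hμ_of_le : ∀ t ≤ t₃, μ t = μ₁ t := fun t ht => blend_of_le h₃ ht
  have hρs : ∀ t > s₀, ContDiffAt ℝ ∞ ρ t := fun t ht =>
    contDiffAt_blend ht₂ (fun h => hf t (hmem t ht h)) (contDiffAt_id.add contDiffAt_const)
  have hds : ∀ s ∈ Ioo s₀ b, ContDiffAt ℝ ∞ (deriv f) s := fun s hs =>
    (hf s hs).derivWithin (by simp)
  have hMs : ∀ s ∈ Ioo s₀ b, ContDiffAt ℝ ∞ M s := fun s hs => by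
    have h0 : f s ≠ 0 := (hQ0.trans_lt (hfQ s hs)).ne'
    exact ((hf s hs).div_const 2).mul ((contDiffAt_const.sub ((hds s hs).pow 2)).add
      (contDiffAt_const.div ((hf s hs).pow 2) (pow_ne_zero 2 h0)))
  have hμ₁s : ∀ t > s₀, ContDiffAt ℝ ∞ μ₁ t := fun t ht =>
    contDiffAt_blend ht₂ (fun h => hMs t (hmem t ht h)) contDiffAt_const
  have hμs : ∀ t > s₀, ContDiffAt ℝ ∞ μ t := fun t ht =>
    contDiffAt_blend h₃ (fun _ => hμ₁s t ht) contDiffAt_const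
  have hf' : ∀ s ∈ Ioo s₀ b, HasDerivAt f (deriv f s) s := fun s hs =>
    ((hf s hs).differentiableAt (by simp)).hasDerivAt
  have hρd : ∀ t > s₀, 0 < deriv ρ t := fun t ht => by
    have hl : ∃ l : ℝ, 0 < l ∧ l ≤ 1 ∧ (t ≤ t₂ → l ≤ deriv f t) := by
      by_cases h : t ≤ t₂
      · exact ⟨min 1 (deriv f t), lt_min one_pos (hd t (hmem t ht h)), min_le_left _ _,
          fun _ => min_le_right _ _⟩
      · exact ⟨1, one_pos, le_rfl, fun h' => absurd h' h⟩
    obtain ⟨l, hl0, hl1, hl2⟩ := hl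
    obtain ⟨d, hd, hld⟩ := exists_hasDerivAt_blend (u := f) (v := fun t => t + κ) ht₂
      (fun h => ⟨_, hf' t (hmem t ht h), hl2 h⟩) ((hasDerivAt_id t).add_const κ) hl1
      fun h h' => by
        have := hfm.monotoneOn (hmem t ht h') hm₂ h'
        linarith
    rw [hρ, hd.deriv]
    linarith
  have hρm : StrictMonoOn ρ (Ioi s₀) := by
    refine strictMonoOn_of_deriv_pos (convex_Ioi _)
      (fun s hs => (hρs s hs).continuousAt.continuousWithinAt) fun s hs => ?_
    rw [interior_Ioi] at hs
    exact hρd s hs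
  have hρQ : ∀ t > s₀, |Q| < ρ t := fun t ht => by
    rcases le_total t t₁ with h | h
    · rw [hρ_of_le t h]
      exact hfQ t (hmem t ht (h.trans ht₂.le))
    · refine lt_of_lt_of_le ?_ (hρm.monotoneOn ht₁ ht h)
      rw [hρ_of_le t₁ le_rfl]
      exact hfQ t₁ hm₁
  have hμ₁d : ∀ t > s₀, ∃ d, HasDerivAt μ₁ d t ∧ 0 ≤ d := fun t ht =>
    exists_hasDerivAt_blend ht₂ (fun h => by
      have hs := hmem t ht h
      have h0 : 0 < f t := hQ0.trans_lt (hfQ t hs)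
      refine ⟨_, hasDerivAt_radialMass (hf' t hs)
        ((hds t hs).differentiableAt (by simp)).hasDerivAt h0.ne', ?_⟩
      exact mul_nonneg (half_pos (hd t hs)).le (hdec t hs)) (hasDerivAt_const t c) le_rfl
      fun _ h' => (hM t (hmem t ht h')).le
  have hμ₁c : ∀ t > s₀, μ₁ t ≤ c := fun t ht =>
    blend_le ht₂ (fun h => (hM t (hmem t ht h.le)).le) le_rfl
  have hμd : ∀ t > s₀, 0 ≤ deriv μ t := fun t ht => by
    obtain ⟨d, hd, hld⟩ := exists_hasDerivAt_blend (u := μ₁) (v := fun _ => m) h₃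
      (fun _ => hμ₁d t ht) (hasDerivAt_const t m) le_rfl fun _ _ => ((hμ₁c t ht).trans_lt hcm).le
    rw [hμ, hd.deriv]
    exact hld
  have hμm : ∀ t > s₀, μ t ≤ m := fun t ht =>
    blend_le h₃ (fun _ => ((hμ₁c t ht).trans_lt hcm).le) le_rfl
  have hV : ∀ t > s₀, 2 * μ t * ρ t < ρ t ^ 2 + Q ^ 2 := fun t ht => by
    have hρ0 : 0 < ρ t := hQ0.trans_lt (hρQ t ht)
    rcases le_or_gt t t₁ with h | h
    -- Before `t₁` the data are those of `f`, for which `V = f'² > 0`.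
    · rw [hμ_of_le t (by linarith), hμ₁, blend_of_le ht₂ h, hMdef, hρ_of_le t h]
      rw [hρ_of_le t h] at hρ0
      have := mul_pos (pow_pos hρ0 2) (pow_pos (hd t (hmem t ht (h.trans ht₂.le))) 2)
      have e : 2 * radialMass Q (f t) (deriv f t) * f t =
          f t ^ 2 + Q ^ 2 - f t ^ 2 * deriv f t ^ 2 := by
        rw [radialMass]
        field_simp
        ring
      simp only [e]
      linarith
    · rcases le_or_gt t t₃ with h' | h'
      · have h1 : μ t ≤ c := hμ_of_le t h' ▸ hμ₁c t ht
        have h2 : f t₁ ≤ ρ t := hρ_of_le t₁ le_rfl ▸ hρm.monotoneOn ht₁ ht h.le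
        have h3 := hfQ t₁ hm₁
        have h4 := hc t₁ hm₁
        have h5 : Q ^ 2 < f t₁ ^ 2 := sq_lt_sq' (by linarith [neg_abs_le Q]) (by
          linarith [le_abs_self Q])
        have h6 : 0 < f t₁ := hQ0.trans_lt h3
        -- Monotonicity of `r + Q²/r` for `r > |Q|`, with denominators cleared: `f₁(ρ² + Q²) - ρ(f₁²
        -- + Q²) = (ρ - f₁)(f₁ρ - Q²) ≥ 0`, where `f₁ = f t₁`.
        have h7 : 2 * c * ρ t < ρ t ^ 2 + Q ^ 2 := by
          have h8 : f t₁ * (2 * c * ρ t) < f t₁ * (ρ t ^ 2 + Q ^ 2) := by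
            nlinarith [mul_nonneg (sub_nonneg.2 h2) (sub_nonneg.2 (h5.le.trans
              (by nlinarith : f t₁ ^ 2 ≤ f t₁ * ρ t)))]
          exact lt_of_mul_lt_mul_left h8 h6.le
        nlinarith
      · have h1 := hμm t ht
        have h2 : 2 * m < ρ t := by rw [hρ_of_ge t (by linarith)]; linarith
        nlinarith [sq_nonneg Q]
  refine ⟨ρ, μ, κ, t₁, t₃ + 1, ht₁, ht₁b, by linarith, by linarith, hρ_of_le, fun t ht => ?_,
    fun t ht => ⟨hρs t ht, hμs t ht, hρd t ht, hμd t ht, hρQ t ht, hV t ht⟩,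
    fun t ht => ⟨hρ_of_ge t (by linarith), blend_of_ge h₃ ht⟩⟩
  rw [hμ_of_le t (by linarith [ht.2]), hμ₁, blend_of_le ht₂ ht.2.le]

/-- The radius function of the extension, with the inverse `G` of its restriction to the end. -/
theorem exists_profile_of_Ioo {s₀ b Q c m : ℝ} {f : ℝ → ℝ} (hsb : s₀ < b)
    (hf : ∀ s ∈ Ioo s₀ b, ContDiffAt ℝ ∞ f s) (hd : ∀ s ∈ Ioo s₀ b, 0 < deriv f s)
    (hfQ : ∀ s ∈ Ioo s₀ b, |Q| < f s)
    (hdec : ∀ s ∈ Ioo s₀ b, 0 ≤ 1 - deriv f s ^ 2 - 2 * f s * deriv (deriv f) s - Q ^ 2 / f s ^ 2)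
    (hM : ∀ s ∈ Ioo s₀ b, radialMass Q (f s) (deriv f s) < c)
    (hc : ∀ s ∈ Ioo s₀ b, 2 * c * f s < f s ^ 2 + Q ^ 2) (hQc : |Q| < c) (hcm : c < m) :
    ∃ (F G : ℝ → ℝ) (c₁ s₁ r₁ : ℝ), s₀ < c₁ ∧ c₁ < b ∧ c₁ < s₁ ∧ 2 * m < r₁ ∧
      (∀ s ≤ c₁, F s = f s) ∧
      (∀ s > s₀, ContDiffAt ℝ ∞ F s ∧ 0 < F s ∧ 0 < deriv F s ∧
        0 ≤ 1 - deriv F s ^ 2 - 2 * F s * deriv (deriv F) s - Q ^ 2 / F s ^ 2) ∧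
      ContDiff ℝ ∞ G ∧ StrictMono G ∧ (∀ r ≥ r₁, s₁ ≤ G r ∧ F (G r) = r) ∧
      (∀ s ≥ s₁, r₁ ≤ F s ∧ G (F s) = s) ∧
      ∀ s ≥ s₁, deriv F s = Real.sqrt (1 - 2 * m / F s + Q ^ 2 / F s ^ 2) := by
  obtain ⟨ρ, μ, κ, t₁, t₄, ht₁, ht₁b, ht₄, ht₄m, hρf, hμf, hgen, hend⟩ :=
    exists_radius_mass hsb hf hd hfQ hdec hM hc hQc hcm
  have hQ0 := abs_nonneg Q
  have hm : 0 < m := by linarith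
  -- The square of the derivative that the radius must have in arc length for its mass to be `μ`.
  set V : ℝ → ℝ := fun t => 1 - 2 * μ t / ρ t + Q ^ 2 / ρ t ^ 2 with hV
  have hρ0 : ∀ t > s₀, 0 < ρ t := fun t ht => hQ0.trans_lt (hgen t ht).2.2.2.2.1
  have hV0 : ∀ t > s₀, 0 < V t := fun t ht => by
    have h0 := hρ0 t ht
    have h1 := (hgen t ht).2.2.2.2.2
    have : V t = (ρ t ^ 2 + Q ^ 2 - 2 * μ t * ρ t) / ρ t ^ 2 := by
      simp only [hV]; field_simp
      ring
    rw [this]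
    exact div_pos (by linarith) (by positivity)
  have hVs : ∀ t > s₀, ContDiffAt ℝ ∞ V t := fun t ht => by
    obtain ⟨h1, h2, -⟩ := hgen t ht
    have h0 := (hρ0 t ht).ne'
    exact (contDiffAt_const.sub ((contDiffAt_const.mul h2).div h1 h0)).add
      (contDiffAt_const.div (h1.pow 2) (pow_ne_zero 2 h0))
  have hρf' : ∀ t < t₁, deriv ρ t = deriv f t := fun t ht => by
    refine Filter.EventuallyEq.deriv_eq ?_
    filter_upwards [gt_mem_nhds ht] with x hx using hρf x hx.le
  have hVf : ∀ t ∈ Ioo s₀ t₁, Real.sqrt (V t) = deriv ρ t := fun t ht => by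
    have h0 := (hρ0 t ht.1).ne'
    rw [hρf t ht.2.le] at h0
    rw [hρf' t ht.2, Real.sqrt_eq_iff_mul_self_eq (hV0 t ht.1).le (hd t ⟨ht.1, ht.2.trans ht₁b⟩).le]
    simp only [hV, hμf t ht, hρf t ht.2.le, radialMass]
    field_simp
    ring
  -- This is `ds/dt`. For `t ≤ s₀` nothing is known about `ρ` and `V`, so the value `1` is imposed;
  -- on `(s₀, t₁)` the quotient is `1` too, which makes `h` smooth on the whole line.
  set h : ℝ → ℝ := fun t => if t < t₁ then 1 else deriv ρ t / Real.sqrt (V t) with hh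
  have hh_eq : ∀ t > s₀, h t = deriv ρ t / Real.sqrt (V t) := fun t ht => by
    by_cases h' : t < t₁
    · simp only [hh, h', if_true]
      rw [hVf t ⟨ht, h'⟩, div_self (hgen t ht).2.2.1.ne']
    · simp only [hh, h', if_false]
  have hh1 : ∀ t < t₁, h t = 1 := fun t ht => if_pos ht
  have hhs : ContDiff ℝ ∞ h := by
    refine contDiff_iff_contDiffAt.2 fun t => ?_
    rcases lt_or_ge t t₁ with ht | ht
    · refine contDiffAt_const (c := (1 : ℝ)) |>.congr_of_eventuallyEq ?_
      filter_upwards [gt_mem_nhds ht] with x hx using hh1 x hx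
    · have hs : s₀ < t := by linarith
      have : ContDiffAt ℝ ∞ (fun t => deriv ρ t / Real.sqrt (V t)) t :=
        ((hgen t hs).1.derivWithin (by simp)).div ((hVs t hs).sqrt (hV0 t hs).ne')
          (Real.sqrt_pos.2 (hV0 t hs)).ne'
      refine this.congr_of_eventuallyEq ?_
      filter_upwards [lt_mem_nhds hs] with x hx using hh_eq x hx
  have hhpos : ∀ t, 0 < h t := fun t => by
    rcases lt_or_ge t t₁ with ht | ht
    · rw [hh1 t ht]; exact one_pos
    · rw [hh_eq t (by linarith)]
      exact div_pos (hgen t (by linarith)).2.2.1 (Real.sqrt_pos.2 (hV0 t (by linarith)))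
  have hρend : ∀ t > t₄, deriv ρ t = 1 := fun t ht => by
    have : ρ =ᶠ[nhds t] fun t => t + κ := by
      filter_upwards [lt_mem_nhds ht] with x hx using (hend x hx.le).1
    rw [this.deriv_eq]
    simp
  -- On the end `ρ' = 1`, and `V ≤ 1` because `Q² ≤ 2mρ`, by `|Q| < m` and `|Q| < ρ`; hence even `h
  -- ≥ 1`.
  have hhT : ∀ t ≥ t₄ + 1, 1 / 2 ≤ h t := fun t ht => by
    have hs : s₀ < t := by linarith
    have h0 := hρ0 t hs
    have h1 := (hgen t hs).2.2.2.2.1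
    have h2 : V t ≤ 1 := by
      have h3 : Q ^ 2 ≤ 2 * m * ρ t := by rw [← sq_abs]; nlinarith
      have h4 : V t = 1 - (2 * m * ρ t - Q ^ 2) / ρ t ^ 2 := by
        simp only [hV, (hend t (by linarith)).2]; field_simp
        ring
      rw [h4]
      linarith [div_nonneg (sub_nonneg.2 h3) (sq_nonneg (ρ t))]
    have h5 : Real.sqrt (V t) ≤ 1 := Real.sqrt_le_one.2 h2
    rw [hh_eq t hs, hρend t (by linarith), le_div_iff₀ (Real.sqrt_pos.2 (hV0 t hs))]
    linarith
  obtain ⟨S, hSm, hS, hS', hSd, hSleft⟩ := exists_diffeo_of_deriv hhs hhpos hh1 hhT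
  have hτleft : ∀ s ≤ t₁, S.symm s = s := fun s hs => by
    rw [Homeomorph.symm_apply_eq, hSleft s hs]
  have hτm : StrictMono S.symm := fun x y hxy => by
    rw [← hSm.lt_iff_lt]
    simpa using hxy
  have hτ0 : ∀ s > s₀, s₀ < S.symm s := fun s hs => by
    rw [← hτleft s₀ ht₁.le]
    exact hτm hs
  have hτd : ∀ s, HasDerivAt S.symm (h (S.symm s))⁻¹ s := fun s =>
    HasDerivAt.of_local_left_inverse (S.symm.continuous.continuousAt) (hSd _) (hhpos _).ne'
      (Filter.Eventually.of_forall S.apply_symm_apply)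
  set F : ℝ → ℝ := fun s => ρ (S.symm s) with hF
  have hFd : ∀ s > s₀, HasDerivAt F (Real.sqrt (V (S.symm s))) s := fun s hs => by
    have ht := hτ0 s hs
    have := (((hgen _ ht).1.differentiableAt (by simp)).hasDerivAt).comp s (hτd s)
    refine this.congr_deriv ?_
    rw [hh_eq _ ht, inv_div, mul_div_cancel₀ _ (hgen _ ht).2.2.1.ne']
  have hFd' : ∀ s > s₀, deriv F s = Real.sqrt (V (S.symm s)) := fun s hs => (hFd s hs).deriv
  have hFs : ∀ s > s₀, ContDiffAt ℝ ∞ F s := fun s hs =>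
    (hgen _ (hτ0 s hs)).1.comp s hS'.contDiffAt
  have hFd2 : ∀ s > s₀, HasDerivAt (deriv F) (deriv (deriv F) s) s := fun s hs =>
    (((hFs s hs).derivWithin (m := ∞) (by simp)).differentiableAt (by simp)).hasDerivAt
  have hF0 : ∀ s > s₀, 0 < F s := fun s hs => hρ0 _ (hτ0 s hs)
  have hFpos : ∀ s > s₀, 0 < deriv F s := fun s hs => by
    rw [hFd' s hs]; exact Real.sqrt_pos.2 (hV0 _ (hτ0 s hs))
  -- Substituting `F' = √V` into the mass returns `μ`.
  have hmass : ∀ s > s₀, radialMass Q (F s) (deriv F s) = μ (S.symm s) := fun s hs => by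
    have h0 := (hF0 s hs).ne'
    rw [hFd' s hs, radialMass, Real.sq_sqrt (hV0 _ (hτ0 s hs)).le]
    simp only [hV, hF] at h0 ⊢
    field_simp
    ring
  -- On the end `ρ(t) = t + κ`, so `F` is inverted by `r ↦ S(r - κ)`; this formula is smooth and
  -- increasing on the whole line.
  refine ⟨F, fun r => S (r - κ), (s₀ + t₁) / 2, S t₄, t₄ + κ, by linarith, by linarith, ?_, ht₄m,
    fun s hs => ?_, fun s hs => ⟨hFs s hs, hF0 s hs, hFpos s hs, ?_⟩,
    hS.comp (contDiff_id.sub contDiff_const), fun x y hxy => hSm (by simpa using hxy),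
    fun r hr => ⟨hSm.monotone (by linarith), ?_⟩, fun s hs => ?_, fun s hs => ?_⟩
  · have : S t₁ < S t₄ := hSm ht₄
    rw [hSleft t₁ le_rfl] at this
    linarith
  · simp only [hF]
    rw [hτleft s (by linarith), hρf s (by linarith)]
  -- The derivative of the mass is computed twice: from `F`, as `F'/2` times the wanted quantity,
  -- and as `μ'/h ≥ 0`.
  · have h1 := hasDerivAt_radialMass (Q := Q) ((hFd' s hs).symm ▸ hFd s hs) (hFd2 s hs)
      (hF0 s hs).ne'
    have h2 : HasDerivAt (fun s => μ (S.symm s)) _ s :=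
      (((hgen _ (hτ0 s hs)).2.1.differentiableAt (by simp)).hasDerivAt).comp s (hτd s)
    have h3 := h1.unique (h2.congr_of_eventuallyEq (by
      filter_upwards [lt_mem_nhds hs] with x hx using hmass x hx))
    have h4 : 0 ≤ deriv μ (S.symm s) * (h (S.symm s))⁻¹ :=
      mul_nonneg (hgen _ (hτ0 s hs)).2.2.2.1 (inv_pos.2 (hhpos _)).le
    rw [← h3] at h4
    exact nonneg_of_mul_nonneg_right h4 (half_pos (hFpos s hs))
  · simp only [hF, Homeomorph.symm_apply_apply]
    rw [(hend _ (by linarith)).1]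
    ring
  · have ht : t₄ ≤ S.symm s := by
      rw [← hSm.le_iff_le]; simpa using hs
    simp only [hF, (hend _ ht).1, add_sub_cancel_right, Homeomorph.apply_symm_apply, and_true]
    linarith
  · have ht : t₄ ≤ S.symm s := by
      rw [← hSm.le_iff_le]; simpa using hs
    have hs0 : s₀ < s := by
      have : S t₁ < S t₄ := hSm ht₄
      rw [hSleft t₁ le_rfl] at this
      linarith
    rw [hFd' s hs0]
    simp only [hV, hF, (hend _ ht).2]

open Filter Topology in
theorem exists_profile {a b Q m : ℝ} (hab : a < b) {f : ℝ → ℝ}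
    (hf : ContDiffOn ℝ ∞ f (Icc a b)) (hpos : ∀ s ∈ Icc a b, 0 < f s)
    (hdec : ∀ s ∈ Ioo a b, 0 ≤ 1 - deriv f s ^ 2 - 2 * f s * deriv (deriv f) s - Q ^ 2 / f s ^ 2)
    (hfb : |Q| < f b) (hd : 0 < derivWithin f (Icc a b) b)
    (hQM : |Q| < radialMass Q (f b) (derivWithin f (Icc a b) b))
    (hMm : radialMass Q (f b) (derivWithin f (Icc a b) b) < m) :
    ∃ (F G : ℝ → ℝ) (s₀ c₁ s₁ r₁ : ℝ), (a + b) / 2 < s₀ ∧ s₀ < c₁ ∧ c₁ < b ∧ c₁ < s₁ ∧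
      2 * m < r₁ ∧ (∀ s ≤ c₁, F s = f s) ∧
      (∀ s > s₀, ContDiffAt ℝ ∞ F s ∧ 0 < F s ∧ 0 < deriv F s ∧
        0 ≤ 1 - deriv F s ^ 2 - 2 * F s * deriv (deriv F) s - Q ^ 2 / F s ^ 2) ∧
      ContDiff ℝ ∞ G ∧ StrictMono G ∧ (∀ r ≥ r₁, s₁ ≤ G r ∧ F (G r) = r) ∧
      (∀ s ≥ s₁, r₁ ≤ F s ∧ G (F s) = s) ∧
      ∀ s ≥ s₁, deriv F s = Real.sqrt (1 - 2 * m / F s + Q ^ 2 / F s ^ 2) := by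
  have hb : b ∈ Icc a b := right_mem_Icc.2 hab.le
  have hfb0 := hpos b hb
  have hQ0 := abs_nonneg Q
  have hlt : radialMass Q (f b) (derivWithin f (Icc a b) b) < (f b ^ 2 + Q ^ 2) / (2 * f b) := by
    have : radialMass Q (f b) (derivWithin f (Icc a b) b) =
        (f b ^ 2 + Q ^ 2) / (2 * f b) - f b * derivWithin f (Icc a b) b ^ 2 / 2 := by
      rw [radialMass]; field_simp
      ring
    rw [this]
    have := mul_pos hfb0 (pow_pos hd 2)
    linarith
  -- The intermediate mass lies above the Hawking mass of `Σ_b`, but below both `m` and the value at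
  -- which `V` would vanish at radius `f b`. The gap exists because `f'(b) > 0`.
  obtain ⟨c, hc1, hc2⟩ := exists_between (lt_min hMm hlt)
  obtain ⟨hcm, hc3⟩ := lt_min_iff.1 hc2
  rw [lt_div_iff₀ (by positivity)] at hc3
  have hfc : ContinuousWithinAt f (Icc a b) b := hf.continuousOn b hb
  have hdc : ContinuousWithinAt (derivWithin f (Icc a b)) (Icc a b) b :=
    hf.continuousOn_derivWithin (uniqueDiffOn_Icc hab) (by simp) b hb
  have hMc : ContinuousWithinAt (fun s => radialMass Q (f s) (derivWithin f (Icc a b) s))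
      (Icc a b) b :=
    (hfc.div_const 2).mul ((continuousWithinAt_const.sub (hdc.pow 2)).add
      (continuousWithinAt_const.div (hfc.pow 2) (pow_ne_zero 2 hfb0.ne')))
  have e1 := hfc.eventually (lt_mem_nhds hfb)
  have e2 := hdc.eventually (lt_mem_nhds hd)
  have e3 := hMc.eventually (gt_mem_nhds hc1)
  have hcc : ContinuousWithinAt (fun s => f s ^ 2 + Q ^ 2 - c * (2 * f s)) (Icc a b) b :=
    ((hfc.pow 2).add continuousWithinAt_const).sub
      (continuousWithinAt_const.mul (continuousWithinAt_const.mul hfc))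
  have e4 := hcc.eventually (lt_mem_nhds (sub_pos.2 hc3))
  have e5 : ∀ᶠ s in 𝓝[Icc a b] b, (a + b) / 2 < s :=
    mem_nhdsWithin_of_mem_nhds (lt_mem_nhds (by linarith))
  have hle : 𝓝[<] b ≤ 𝓝[Icc a b] b := by
    rw [← nhdsWithin_Ioo_eq_nhdsLT hab]
    exact nhdsWithin_mono _ Ioo_subset_Icc_self
  have e6 := hle (e1.and (e2.and (e3.and (e4.and e5))))
  obtain ⟨l, hl, hl'⟩ := (mem_nhdsLT_iff_exists_Ioo_subset' hab).1 e6
  -- All modifications take place beyond the midpoint, so the given half of the collar is kept.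
  set s₀ := max l ((a + b) / 2) with hs₀
  obtain ⟨s₀', hs₀'⟩ := exists_between (show s₀ < b from max_lt hl (by linarith))
  have hsub : ∀ s ∈ Ioo s₀' b, s ∈ Ioo l b ∧ s ∈ Ioo a b := fun s hs => by
    have h1 := le_max_left l ((a + b) / 2)
    have h2 := le_max_right l ((a + b) / 2)
    exact ⟨⟨by linarith [hs.1, hs₀'.1], hs.2⟩, ⟨by linarith [hs.1, hs₀'.1], hs.2⟩⟩
  have hdw : ∀ s ∈ Ioo a b, derivWithin f (Icc a b) s = deriv f s := fun s hs =>
    derivWithin_of_mem_nhds (Icc_mem_nhds hs.1 hs.2)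
  obtain ⟨F, G, c₁, s₁, r₁, H1, H⟩ := exists_profile_of_Ioo (s₀ := s₀') (b := b) (Q := Q) (c := c)
    (m := m) (f := f) hs₀'.2
    (fun s hs => hf.contDiffAt (Icc_mem_nhds (hsub s hs).2.1 (hsub s hs).2.2))
    (fun s hs => by rw [← hdw s (hsub s hs).2]; exact (hl' (hsub s hs).1).2.1)
    (fun s hs => (hl' (hsub s hs).1).1) (fun s hs => hdec s (hsub s hs).2)
    (fun s hs => by rw [← hdw s (hsub s hs).2]; exact (hl' (hsub s hs).1).2.2.1)
    (fun s hs => by linarith [(hl' (hsub s hs).1).2.2.2.1]) (hQM.trans hc1) hcm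
  exact ⟨F, G, s₀', c₁, s₁, r₁, (le_max_right _ _).trans_lt hs₀'.1, H1, H⟩

/-! ### Calculus of functions with decaying derivatives. -/

/-- On the exterior of the ball of radius `R`, `u = O_j(|x|^p)`: the derivatives of order `i ≤ j` of
`u` are `O(|x|^(p - i))`. -/
def HasDecay (R : ℝ) : ℕ → ℤ → (E3 → ℝ) → Prop
  | 0, p, u => ∃ C, ∀ x, R < ‖x‖ → |u x| ≤ C * ‖x‖ ^ p
  | j + 1, p, u => (∃ C, ∀ x, R < ‖x‖ → |u x| ≤ C * ‖x‖ ^ p) ∧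
      (∀ x, R < ‖x‖ → DifferentiableAt ℝ u x) ∧ ∀ k, HasDecay R j (p - 1) (partialE3 k u)

theorem hasFDerivAt_norm {x : E3} (h : x ≠ 0) :
    HasFDerivAt (fun x : E3 => ‖x‖) (‖x‖⁻¹ • innerSL ℝ x) x := by
  have h2 : HasFDerivAt (fun x : E3 => Real.sqrt (‖x‖ ^ 2)) _ x :=
    ((hasStrictFDerivAt_norm_sq x).hasFDerivAt).sqrt (by positivity)
  have h3 : (fun x : E3 => Real.sqrt (‖x‖ ^ 2)) = fun x => ‖x‖ :=
    funext fun x => Real.sqrt_sq (norm_nonneg x)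
  rw [h3, Real.sqrt_sq (norm_nonneg x)] at h2
  refine h2.congr_fderiv ?_
  ext v
  simp
  ring

theorem eventually_exterior {R : ℝ} {x : E3} (hx : R < ‖x‖) : ∀ᶠ y in nhds x, R < ‖y‖ :=
  (isOpen_lt continuous_const continuous_norm).mem_nhds hx

theorem partialE3_congr {R : ℝ} {u v : E3 → ℝ} (h : ∀ x, R < ‖x‖ → u x = v x) (k : Fin 3) {x : E3}
    (hx : R < ‖x‖) : partialE3 k u x = partialE3 k v x := by
  have : u =ᶠ[nhds x] v := (eventually_exterior hx).mono h
  rw [partialE3, partialE3, this.fderiv_eq]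

namespace HasDecay

variable {R : ℝ} {j : ℕ} {p q : ℤ} {u v : E3 → ℝ}

theorem bound (h : HasDecay R j p u) : ∃ C, ∀ x, R < ‖x‖ → |u x| ≤ C * ‖x‖ ^ p := by
  cases j with
  | zero => exact h
  | succ j => exact h.1

theorem congr (h : HasDecay R j p u) (huv : ∀ x, R < ‖x‖ → v x = u x) : HasDecay R j p v := by
  induction j generalizing p u v with
  | zero =>
    obtain ⟨C, hC⟩ := h
    exact ⟨C, fun x hx => by rw [huv x hx]; exact hC x hx⟩
  | succ j ih =>
    obtain ⟨⟨C, hC⟩, hd, hk⟩ := h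
    exact ⟨⟨C, fun x hx => by rw [huv x hx]; exact hC x hx⟩,
      fun x hx => (hd x hx).congr_of_eventuallyEq ((eventually_exterior hx).mono huv),
      fun k => ih (hk k) fun x hx => partialE3_congr huv k hx⟩

theorem of_succ (h : HasDecay R (j + 1) p u) : HasDecay R j p u := by
  induction j generalizing p u with
  | zero => exact h.1
  | succ j ih => exact ⟨h.1, h.2.1, fun k => ih (h.2.2 k)⟩

/-- Powers of `|x|` are ordered by their exponents only for `|x| ≥ 1`, hence the bound on `R`. -/
theorem weaken (hR : 1 ≤ R) (h : HasDecay R j p u) (hpq : p ≤ q) : HasDecay R j q u := by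
  have key : ∀ {p q : ℤ} {u : E3 → ℝ}, p ≤ q → (∃ C, ∀ x, R < ‖x‖ → |u x| ≤ C * ‖x‖ ^ p) →
      ∃ C, ∀ x, R < ‖x‖ → |u x| ≤ C * ‖x‖ ^ q := by
    rintro p q u hpq ⟨C, hC⟩
    refine ⟨|C|, fun x hx => (hC x hx).trans ?_⟩
    have h1 : 1 ≤ ‖x‖ := by linarith
    exact mul_le_mul (le_abs_self C) (zpow_le_zpow_right₀ h1 hpq) (by positivity) (abs_nonneg C)
  induction j generalizing p q u with
  | zero => exact key hpq h
  | succ j ih => exact ⟨key hpq h.1, h.2.1, fun k => ih (h.2.2 k) (by omega)⟩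

theorem zero (R : ℝ) (j : ℕ) (p : ℤ) : HasDecay R j p fun _ => 0 := by
  induction j generalizing p with
  | zero => exact ⟨0, fun x _ => by simp⟩
  | succ j ih =>
    exact ⟨⟨0, fun x _ => by simp⟩, fun x _ => differentiableAt_const _,
      fun k => (ih (p - 1)).congr fun x _ => by simp [partialE3]⟩

theorem const (R : ℝ) (j : ℕ) (c : ℝ) : HasDecay R j 0 fun _ => c := by
  cases j with
  | zero => exact ⟨|c|, fun x _ => by simp⟩
  | succ j =>
    exact ⟨⟨|c|, fun x _ => by simp⟩, fun x _ => differentiableAt_const _,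
      fun k => (zero R j _).congr fun x _ => by simp [partialE3]⟩

theorem add (hu : HasDecay R j p u) (hv : HasDecay R j p v) :
    HasDecay R j p fun x => u x + v x := by
  have key : ∀ {p : ℤ} {u v : E3 → ℝ}, (∃ C, ∀ x, R < ‖x‖ → |u x| ≤ C * ‖x‖ ^ p) →
      (∃ C, ∀ x, R < ‖x‖ → |v x| ≤ C * ‖x‖ ^ p) →
      ∃ C, ∀ x, R < ‖x‖ → |u x + v x| ≤ C * ‖x‖ ^ p := by
    rintro p u v ⟨C, hC⟩ ⟨C', hC'⟩
    exact ⟨C + C', fun x hx => (abs_add_le _ _).trans (by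
      rw [add_mul]; exact add_le_add (hC x hx) (hC' x hx))⟩
  induction j generalizing p u v with
  | zero => exact key hu hv
  | succ j ih =>
    refine ⟨key hu.1 hv.1, fun x hx => (hu.2.1 x hx).add (hv.2.1 x hx),
      fun k => (ih (hu.2.2 k) (hv.2.2 k)).congr fun x hx => ?_⟩
    rw [partialE3, fderiv_fun_add (hu.2.1 x hx) (hv.2.1 x hx)]
    rfl

theorem mul (hR : 0 ≤ R) (hu : HasDecay R j p u) (hv : HasDecay R j q v) :
    HasDecay R j (p + q) fun x => u x * v x := by
  have key : ∀ {p q : ℤ} {u v : E3 → ℝ}, (∃ C, ∀ x, R < ‖x‖ → |u x| ≤ C * ‖x‖ ^ p) →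
      (∃ C, ∀ x, R < ‖x‖ → |v x| ≤ C * ‖x‖ ^ q) →
      ∃ C, ∀ x, R < ‖x‖ → |u x * v x| ≤ C * ‖x‖ ^ (p + q) := by
    rintro p q u v ⟨C, hC⟩ ⟨C', hC'⟩
    refine ⟨C * C', fun x hx => ?_⟩
    have h0 : 0 < ‖x‖ := hR.trans_lt hx
    rw [abs_mul, zpow_add₀ h0.ne', mul_mul_mul_comm]
    exact mul_le_mul (hC x hx) (hC' x hx) (abs_nonneg _) ((abs_nonneg _).trans (hC x hx))
  induction j generalizing p q u v with
  | zero => exact key hu hv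
  | succ j ih =>
    refine ⟨key hu.1 hv.1, fun x hx => (hu.2.1 x hx).mul (hv.2.1 x hx), fun k => ?_⟩
    have h1 := ih hu.of_succ (hv.2.2 k)
    have h2 := ih hv.of_succ (hu.2.2 k)
    rw [show p + (q - 1) = p + q - 1 by ring] at h1
    rw [show q + (p - 1) = p + q - 1 by ring] at h2
    refine (h1.add h2).congr fun x hx => ?_
    rw [partialE3, fderiv_fun_mul (hu.2.1 x hx) (hv.2.1 x hx)]
    rfl

theorem const_mul (hR : 0 ≤ R) (c : ℝ) (hu : HasDecay R j p u) :
    HasDecay R j p fun x => c * u x := by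
  simpa using (const R j c).mul hR hu

/-- The bound from below is of the same order as the decay. Derivatives follow inductively from
`∂(1/u) = -∂u · (1/u)²`, in which `1/u` is needed to one order less. -/
theorem inv (hR : 0 ≤ R) (hu : HasDecay R j p u) {c : ℝ} (hc : 0 < c)
    (h : ∀ x, R < ‖x‖ → c * ‖x‖ ^ p ≤ |u x|) : HasDecay R j (-p) fun x => (u x)⁻¹ := by
  have h0 : ∀ x, R < ‖x‖ → u x ≠ 0 := fun x hx => by
    have : 0 < ‖x‖ := hR.trans_lt hx
    exact abs_pos.1 (lt_of_lt_of_le (by positivity) (h x hx))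
  have key : ∃ C, ∀ x, R < ‖x‖ → |(u x)⁻¹| ≤ C * ‖x‖ ^ (-p) := by
    refine ⟨c⁻¹, fun x hx => ?_⟩
    have : 0 < ‖x‖ := hR.trans_lt hx
    rw [abs_inv, zpow_neg, ← mul_inv]
    exact inv_anti₀ (by positivity) (h x hx)
  induction j with
  | zero => exact key
  | succ j ih =>
    have h1 := ih hu.of_succ
    refine ⟨key, fun x hx => (hu.2.1 x hx).inv (h0 x hx), fun k => ?_⟩
    have h2 := (((hu.2.2 k).mul hR (h1.mul hR h1)).const_mul hR (-1))
    rw [show p - 1 + (-p + -p) = -p - 1 by ring] at h2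
    refine h2.congr fun x hx => ?_
    have := ((hasDerivAt_inv (h0 x hx)).comp_hasFDerivAt x (hu.2.1 x hx).hasFDerivAt).fderiv
    change fderiv ℝ (fun x => (u x)⁻¹) x = _ at this
    rw [partialE3, this]
    simp [partialE3]
    ring

/-- Induction through `∂√u = ∂u / (2√u)`, with `inv` applied to `√u`, which is bounded away from
zero. -/
theorem sqrt (hR : 0 ≤ R) (hu : HasDecay R j 0 u) {c : ℝ} (hc : 0 < c)
    (h : ∀ x, R < ‖x‖ → c ≤ u x) : HasDecay R j 0 fun x => Real.sqrt (u x) := by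
  have key : ∃ C, ∀ x, R < ‖x‖ → |Real.sqrt (u x)| ≤ C * ‖x‖ ^ (0 : ℤ) := by
    obtain ⟨C, hC⟩ := hu.bound
    refine ⟨Real.sqrt C, fun x hx => ?_⟩
    have := hC x hx
    simp only [zpow_zero, mul_one] at this ⊢
    rw [abs_of_nonneg (Real.sqrt_nonneg _)]
    exact Real.sqrt_le_sqrt ((le_abs_self _).trans this)
  induction j with
  | zero => exact key
  | succ j ih =>
    have h0 : ∀ x, R < ‖x‖ → u x ≠ 0 := fun x hx => (hc.trans_le (h x hx)).ne'
    have h1 := ih hu.of_succ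
    refine ⟨key, fun x hx => (hu.2.1 x hx).sqrt (h0 x hx), fun k => ?_⟩
    have h3 := h1.inv hR (Real.sqrt_pos.2 hc) fun x hx => by
      rw [zpow_zero, mul_one, abs_of_nonneg (Real.sqrt_nonneg _)]
      exact Real.sqrt_le_sqrt (h x hx)
    have h2 := (((hu.2.2 k).mul hR h3).const_mul hR (1 / 2))
    rw [show (0 : ℤ) - 1 + -0 = 0 - 1 by ring] at h2
    refine h2.congr fun x hx => ?_
    rw [partialE3, fderiv_sqrt (hu.2.1 x hx) (h0 x hx)]
    simp [partialE3]
    ring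

theorem coord (R : ℝ) (j : ℕ) (i : Fin 3) : HasDecay R j 1 fun x : E3 => x i := by
  have key : ∃ C, ∀ x : E3, R < ‖x‖ → |x i| ≤ C * ‖x‖ ^ (1 : ℤ) :=
    ⟨1, fun x _ => by simpa using PiLp.norm_apply_le x i⟩
  cases j with
  | zero => exact key
  | succ j =>
    have h : ∀ x : E3, HasFDerivAt (fun x : E3 => x i) (EuclideanSpace.proj (𝕜 := ℝ) i) x :=
      fun x => (EuclideanSpace.proj (𝕜 := ℝ) i).hasFDerivAt
    refine ⟨key, fun x _ => (h x).differentiableAt, fun k => ?_⟩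
    rw [show (1 : ℤ) - 1 = 0 by ring]
    refine (const R j ((EuclideanSpace.proj (𝕜 := ℝ) i : E3 →L[ℝ] ℝ)
      (EuclideanSpace.basisFun (Fin 3) ℝ k))).congr fun x _ => ?_
    rw [partialE3, (h x).fderiv]

/-- Induction through `∂_k |x| = x_k |x|⁻¹`. -/
theorem norm (hR : 0 ≤ R) (j : ℕ) : HasDecay R j 1 fun x : E3 => ‖x‖ := by
  have key : ∃ C, ∀ x : E3, R < ‖x‖ → |‖x‖| ≤ C * ‖x‖ ^ (1 : ℤ) := ⟨1, fun x _ => by simp⟩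
  induction j with
  | zero => exact key
  | succ j ih =>
    have h0 : ∀ x : E3, R < ‖x‖ → x ≠ 0 := fun x hx => norm_pos_iff.1 (hR.trans_lt hx)
    refine ⟨key, fun x hx => (contDiffAt_norm ℝ (h0 x hx)).differentiableAt (n := 1) (by simp),
      fun k => ?_⟩
    have h1 := (coord R j k).mul hR (ih.inv hR one_pos fun x _ => by simp)
    rw [show (1 : ℤ) + -1 = 1 - 1 by ring] at h1
    refine h1.congr fun x hx => ?_
    rw [partialE3, (hasFDerivAt_norm (h0 x hx)).fderiv]
    simp [EuclideanSpace.inner_single_right]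
    ring

theorem norm_inv (hR : 0 ≤ R) (j : ℕ) : HasDecay R j (-1) fun x : E3 => ‖x‖⁻¹ :=
  (norm hR j).inv hR one_pos fun x _ => by simp

end HasDecay

/-! ### Decay of the Reissner–Nordström coefficients. -/

section

variable {m Q R : ℝ}

/-- `r² (1 - 2m/r + Q²/r²) ≥ r² / 2` for `r ≥ 4m`. -/
theorem half_sq_le_rn {r : ℝ} (hr : 0 < r) (h : 4 * m ≤ r) :
    1 / 2 * r ^ 2 ≤ r ^ 2 - 2 * m * r + Q ^ 2 := by nlinarith [sq_nonneg Q]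

theorem hasDecay_rn (hR : 1 ≤ R) (j : ℕ) :
    HasDecay R j 2 fun x => ‖x‖ ^ 2 - 2 * m * ‖x‖ + Q ^ 2 := by
  have hR0 : 0 ≤ R := by linarith
  have h := HasDecay.norm hR0 j
  have h2 := ((h.mul hR0 h).add (((h.const_mul hR0 (-2 * m)).weaken hR (by norm_num)))).add
    ((HasDecay.const R j (Q ^ 2)).weaken hR (by norm_num))
  exact h2.congr fun x _ => by ring

/-- This function is `γ_ik - δ_ik` in the coordinates of the end. The orders of the factors add up
to `1 + 1 + 1 - 1 - 1 - 2 = -1`. -/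
theorem hasDecay_rn_metric (hR : 1 ≤ R) (hm : 4 * m ≤ R) (j : ℕ) (i k : Fin 3) :
    HasDecay R j (-1) fun x => x i * x k *
      ((2 * m * ‖x‖ - Q ^ 2) * (‖x‖⁻¹ * ‖x‖⁻¹ * (‖x‖ ^ 2 - 2 * m * ‖x‖ + Q ^ 2)⁻¹)) := by
  have hR0 : 0 ≤ R := by linarith
  have hi := HasDecay.norm_inv hR0 j
  have h1 : HasDecay R j 1 fun x : E3 => 2 * m * ‖x‖ - Q ^ 2 :=
    (((HasDecay.norm hR0 j).const_mul hR0 (2 * m)).add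
      ((HasDecay.const R j (-Q ^ 2)).weaken hR (by norm_num))).congr fun x _ => by ring
  have h2 := (hasDecay_rn (m := m) (Q := Q) hR j).inv hR0 (c := 1 / 2) (by norm_num) fun x hx => by
    have h0 : 0 < ‖x‖ := by linarith
    exact (half_sq_le_rn h0 (by linarith)).trans (le_abs_self _)
  exact ((HasDecay.coord R j i).mul hR0 (HasDecay.coord R j k)).mul hR0
    (h1.mul hR0 ((hi.mul hR0 hi).mul hR0 h2))

/-- This function is `E^i` on the end: a bounded square root times `x_i |x|⁻³`. -/
theorem hasDecay_rn_field (hR : 1 ≤ R) (hm : 4 * m ≤ R) (j : ℕ) (i : Fin 3) :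
    HasDecay R j (-2) fun x => Q * (Real.sqrt (1 - 2 * m / ‖x‖ + Q ^ 2 / ‖x‖ ^ 2) *
      (x i * (‖x‖⁻¹ * ‖x‖⁻¹ * ‖x‖⁻¹))) := by
  have hR0 : 0 ≤ R := by linarith
  have hi := HasDecay.norm_inv hR0 j
  have h1 := (hasDecay_rn (m := m) (Q := Q) hR j).mul hR0 (hi.mul hR0 hi)
  have h2 : ∀ x : E3, R < ‖x‖ → 1 - 2 * m / ‖x‖ + Q ^ 2 / ‖x‖ ^ 2 =
      (‖x‖ ^ 2 - 2 * m * ‖x‖ + Q ^ 2) * (‖x‖⁻¹ * ‖x‖⁻¹) := fun x hx => by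
    have h0 : 0 < ‖x‖ := by linarith
    field_simp
  have h3 : HasDecay R j 0 fun x => 1 - 2 * m / ‖x‖ + Q ^ 2 / ‖x‖ ^ 2 := h1.congr h2
  have h4 := h3.sqrt hR0 (c := 1 / 2) (by norm_num) fun x hx => by
    have h0 : 0 < ‖x‖ := by linarith
    have := half_sq_le_rn (m := m) (Q := Q) h0 (by linarith)
    rw [h2 x hx, ← mul_inv, ← div_eq_mul_inv, le_div_iff₀ (by positivity)]
    linarith
  exact (h4.mul hR0 ((HasDecay.coord R j i).mul hR0 ((hi.mul hR0 hi).mul hR0 hi))).const_mul hR0 Q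

end

/-! ### Coordinates on the end and asymptotic flatness. -/

/-- The chart at `g x` is the restriction of a map that is smooth in `ℝ³` off the plane `⟨-g x, y⟩ =
1`, and `g x` is not on that plane. -/
theorem contMDiffAt_sphere_of_coe {g : E3 → S2} {x : E3}
    (h : ContDiffAt ℝ ∞ (fun y => (g y : E3)) x) : ContMDiffAt 𝓘(ℝ, E3) (𝓡 2) ∞ g x := by
  rw [contMDiffAt_iff_target]
  refine ⟨Topology.IsInducing.subtypeVal.continuousAt_iff.2 h.continuousAt, ?_⟩
  let U := (OrthonormalBasis.fromOrthogonalSpanSingleton (𝕜 := ℝ) (E := E3) 2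
      (ne_zero_of_mem_unit_sphere (-(g x)))).repr
  have h1 : ContDiffAt ℝ ∞ (stereoToFun ((-(g x) : S2) : E3)) (g x : E3) := by
    refine contDiffOn_stereoToFun.contDiffAt (IsOpen.mem_nhds ?_ ?_)
    · exact isOpen_ne_fun (innerSL ℝ _).continuous continuous_const
    · have : inner ℝ (g x : E3) (g x : E3) = 1 := by simp
      have h' : innerSL ℝ ((-(g x) : S2) : E3) (g x : E3) = -1 := by
        rw [innerSL_apply_apply]
        exact (inner_neg_left (g x : E3) (g x : E3)).trans (congrArg Neg.neg this)
      rw [mem_ofPred_eq, h']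
      norm_num
  exact (U.contDiff.contDiffAt.comp x (h1.comp x h)).contMDiffAt

/-- The direction `x / |x|`. -/
def sphereDir (x : E3) : S2 :=
  if h : x = 0 then ⟨EuclideanSpace.single 0 1, by simp⟩
  else ⟨‖x‖⁻¹ • x, by simp [norm_smul, h]⟩

theorem coe_sphereDir {x : E3} (h : x ≠ 0) : (sphereDir x : E3) = ‖x‖⁻¹ • x := by
  simp [sphereDir, h]

theorem sphereDir_smul {c : ℝ} (hc : 0 < c) (θ : S2) : sphereDir (c • (θ : E3)) = θ := by
  have h : c • (θ : E3) ≠ 0 := smul_ne_zero hc.ne' (ne_zero_of_mem_unit_sphere θ)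
  apply Subtype.ext
  rw [coe_sphereDir h, norm_smul, norm_eq_of_mem_sphere, Real.norm_of_nonneg hc.le, mul_one,
    inv_smul_smul₀ hc.ne']

theorem coe_sphereDir_eventuallyEq {x : E3} (h : x ≠ 0) :
    (fun y => (sphereDir y : E3)) =ᶠ[nhds x] fun y => ‖y‖⁻¹ • y :=
  Filter.Eventually.mono (isOpen_ne.mem_nhds h) fun _ hy => coe_sphereDir hy

theorem contMDiffAt_sphereDir {x : E3} (h : x ≠ 0) : ContMDiffAt 𝓘(ℝ, E3) (𝓡 2) ∞ sphereDir x := by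
  refine contMDiffAt_sphere_of_coe ?_
  refine ContDiffAt.congr_of_eventuallyEq ?_ (coe_sphereDir_eventuallyEq h)
  exact ((contDiffAt_norm ℝ h).inv (norm_ne_zero_iff.2 h)).smul contDiffAt_id

theorem inclDeriv_mfderiv_sphereDir {x : E3} (h : x ≠ 0) (v : E3) :
    inclDeriv (sphereDir x) (mfderiv 𝓘(ℝ, E3) (𝓡 2) sphereDir x v) =
      ‖x‖⁻¹ • v - (‖x‖⁻¹ ^ 3 * inner ℝ x v) • x := by
  have h1 : MDifferentiableAt (𝓡 2) 𝓘(ℝ, E3) (fun x : S2 => (x : E3)) (sphereDir x) :=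
    (contMDiff_coe_sphere (m := 1) _).mdifferentiableAt one_ne_zero
  have h2 : MDifferentiableAt 𝓘(ℝ, E3) (𝓡 2) sphereDir x :=
    (contMDiffAt_sphereDir h).mdifferentiableAt (by simp)
  have h3 := mfderiv_comp_apply x h1 h2 v
  have h4 : mfderiv 𝓘(ℝ, E3) 𝓘(ℝ, E3) ((fun x : S2 => (x : E3)) ∘ sphereDir) x =
    fderiv ℝ (fun y => (sphereDir y : E3)) x := mfderiv_eq_fderiv
  rw [h4, (coe_sphereDir_eventuallyEq h).fderiv_eq] at h3
  have h5 := ((hasDerivAt_inv (norm_ne_zero_iff.2 h)).comp_hasFDerivAt x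
    (hasFDerivAt_norm h)).smul (hasFDerivAt_id x)
  refine h3.symm.trans ((congrArg (fun A => A v) h5.fderiv).trans ?_)
  simp
  match_scalars <;> field_simp

theorem roundMetric_mfderiv_sphereDir {x : E3} (h : x ≠ 0) (u v : E3) :
    roundMetric (sphereDir x) (mfderiv 𝓘(ℝ, E3) (𝓡 2) sphereDir x u)
      (mfderiv 𝓘(ℝ, E3) (𝓡 2) sphereDir x v) =
      ‖x‖⁻¹ ^ 2 * (inner ℝ u v - ‖x‖⁻¹ ^ 2 * inner ℝ x u * inner ℝ x v) := by
  have h0 : ‖x‖ ≠ 0 := norm_ne_zero_iff.2 h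
  rw [roundMetric, inclDeriv_mfderiv_sphereDir h, inclDeriv_mfderiv_sphereDir h]
  simp only [inner_sub_left, inner_sub_right, inner_smul_left, inner_smul_right]
  rw [real_inner_self_eq_norm_sq, real_inner_comm u x]
  simp
  field_simp
  ring

/-- The coordinates of the end. -/
def endChart (G : ℝ → ℝ) (x : E3) : Cyl := (G ‖x‖, sphereDir x)

/-- The inverse of the coordinates of the end. -/
def endChartInv (F : ℝ → ℝ) (p : Cyl) : E3 := F p.1 • (p.2 : E3)

theorem contMDiffAt_endChart {G : ℝ → ℝ} {x : E3} (hG : ContDiff ℝ ∞ G) (hx : x ≠ 0) :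
    ContMDiffAt 𝓘(ℝ, E3) cylModel ∞ (endChart G) x :=
  ContMDiffAt.prodMk (hG.contDiffAt.comp x (contDiffAt_norm ℝ hx)).contMDiffAt
    (contMDiffAt_sphereDir hx)

theorem contMDiffAt_endChartInv {F : ℝ → ℝ} {p : Cyl} (hF : ContDiffAt ℝ ∞ F p.1) :
    ContMDiffAt cylModel 𝓘(ℝ, E3) ∞ (endChartInv F) p := by
  have h1 : ContMDiffAt cylModel 𝓘(ℝ, ℝ) ∞ (fun p : Cyl => F p.1) p :=
    hF.contMDiffAt.comp p contMDiffAt_fst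
  have h2 : ContMDiffAt cylModel 𝓘(ℝ, E3) ∞ (fun p : Cyl => (p.2 : E3)) p :=
    (contMDiff_coe_sphere.contMDiffAt).comp p contMDiffAt_snd
  exact h1.smul h2

theorem mfderiv_endChart {G : ℝ → ℝ} {x : E3} {g : ℝ} (hG : HasDerivAt G g ‖x‖) (hx : x ≠ 0)
    (v : E3) : mfderiv 𝓘(ℝ, E3) cylModel (endChart G) x v =
      ((g * (‖x‖⁻¹ * inner ℝ x v), mfderiv 𝓘(ℝ, E3) (𝓡 2) sphereDir x v) : CylV) := by
  have h1 : HasMFDerivAt 𝓘(ℝ, E3) 𝓘(ℝ, ℝ) (fun x : E3 => G ‖x‖) x (g • ‖x‖⁻¹ • innerSL ℝ x) :=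
    (hG.comp_hasFDerivAt x (hasFDerivAt_norm hx)).hasMFDerivAt
  have h2 := ((contMDiffAt_sphereDir hx).mdifferentiableAt (by simp)).hasMFDerivAt
  have h4 := h1.prodMk h2
  exact congrArg (fun A => A v) h4.mfderiv

theorem mvfderiv_endChartInv_radial {F : ℝ → ℝ} {p : Cyl} (hF : ContDiffAt ℝ ∞ F p.1) (c : ℝ) :
    mvfderiv cylModel (endChartInv F) p ((c, 0) : CylV) = (c * deriv F p.1) • (p.2 : E3) := by
  have h1 : HasMFDerivAt 𝓘(ℝ, ℝ) cylModel (fun t : ℝ => ((t, p.2) : Cyl)) p.1 _ :=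
    (hasMFDerivAt_id p.1).prodMk (hasMFDerivAt_const p.2 p.1)
  have h2 : MDifferentiableAt cylModel 𝓘(ℝ, E3) (endChartInv F) p :=
    (contMDiffAt_endChartInv hF).mdifferentiableAt (by simp)
  have h3 := (h2.hasMFDerivAt.comp p.1 h1).mfderiv
  have h4 : HasDerivAt ((endChartInv F) ∘ fun t : ℝ => ((t, p.2) : Cyl)) (deriv F p.1 • (p.2 : E3))
      p.1 := ((hF.differentiableAt (by simp)).hasDerivAt).smul_const (p.2 : E3)
  rw [h4.hasFDerivAt.hasMFDerivAt.mfderiv] at h3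
  have h5 := congrArg (fun A : ℝ →L[ℝ] E3 => A c) h3
  refine Eq.trans ?_ (h5.symm.trans ?_)
  · rfl
  · simp [smul_smul]

/-- With `r = |x|` one has `|dx|² = dr² + r² g_*`, so the metric is `|dx|² + (G'² - 1) dr²`, where
`dr = |x|⁻¹ ∑ x_i dx_i`. -/
theorem afMetric_endChart {F G : ℝ → ℝ} {x : E3} {g : ℝ} (hG : HasDerivAt G g ‖x‖) (hx : x ≠ 0)
    (hFG : F (G ‖x‖) = ‖x‖) (i j : Fin 3) :
    afMetric (rotMetric F) (endChart G) i j x =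
      (if i = j then 1 else 0) + x i * x j * ((g ^ 2 - 1) * (‖x‖⁻¹ * ‖x‖⁻¹)) := by
  have h0 : ‖x‖ ≠ 0 := norm_ne_zero_iff.2 hx
  rw [afMetric, mfderiv_endChart hG hx, mfderiv_endChart hG hx]
  simp only [rotMetric, warpedMetric]
  change 1 * _ + F (G ‖x‖) ^ 2 * roundMetric (sphereDir x) _ _ = _
  erw [roundMetric_mfderiv_sphereDir hx]
  rw [hFG]
  simp [EuclideanSpace.inner_single_right]
  field_simp
  by_cases h : i = j
  · simp [h]; ring
  · simp [h, Ne.symm h]; ring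

theorem afField_endChart {F G φ : ℝ → ℝ} {x : E3} (hx : x ≠ 0) (hF : ContDiffAt ℝ ∞ F (G ‖x‖))
    (i : Fin 3) : afField (radialField φ) (endChart G) (endChartInv F) i x =
      φ (G ‖x‖) * deriv F (G ‖x‖) * (‖x‖⁻¹ * x i) := by
  have : mvfderiv cylModel (endChartInv F) (endChart G x) (radialField φ (endChart G x)) =
      (φ (G ‖x‖) * deriv F (G ‖x‖)) • (sphereDir x : E3) :=
    mvfderiv_endChartInv_radial (p := endChart G x) hF (φ (G ‖x‖))
  rw [afField, this, coe_sphereDir hx]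
  simp

theorem exists_uniform_bound {ι : Type} [Finite ι] {R : ℝ} {p : ℤ} {u : ι → E3 → ℝ}
    (h : ∀ i, ∃ C, ∀ x, R < ‖x‖ → |u i x| ≤ C * ‖x‖ ^ p) :
    ∃ C, ∀ i x, R < ‖x‖ → |u i x| ≤ C * ‖x‖ ^ p := by
  choose C hC using h
  obtain ⟨B, hB⟩ := (finite_range C).bddAbove
  exact ⟨B, fun i x hx => (hC i x hx).trans
    (mul_le_mul_of_nonneg_right (hB ⟨i, rfl⟩) (by positivity))⟩

theorem integrableOn_exterior_inv_pow_four (c : ℝ) {R : ℝ} (hR : 1 ≤ R) :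
    IntegrableOn (fun x : E3 => c / ‖x‖ ^ 4) {x | R < ‖x‖} := by
  have h1 : Integrable (fun x : E3 => |c| * 16 * (1 + ‖x‖) ^ (-(4 : ℝ))) :=
    (integrable_one_add_norm (by simp; norm_num)).const_mul _
  have hm : MeasurableSet {x : E3 | R < ‖x‖} :=
    (isOpen_lt continuous_const continuous_norm).measurableSet
  refine h1.integrableOn.mono' (Measurable.aestronglyMeasurable (by fun_prop)) ?_
  refine (ae_restrict_iff' hm).2 (Filter.Eventually.of_forall fun x hx => ?_)
  have hx1 : 1 < ‖x‖ := hR.trans_lt hx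
  rw [norm_div, norm_pow, norm_norm, Real.norm_eq_abs, Real.rpow_neg (by positivity),
    show (4 : ℝ) = ((4 : ℕ) : ℝ) by norm_num, Real.rpow_natCast, mul_assoc]
  rw [div_eq_mul_inv]
  refine mul_le_mul_of_nonneg_left ?_ (abs_nonneg c)
  rw [← div_eq_mul_inv, le_div_iff₀ (by positivity), ← div_eq_inv_mul, div_le_iff₀ (by positivity)]
  have : (1 + ‖x‖) ^ 4 ≤ (2 * ‖x‖) ^ 4 := pow_le_pow_left₀ (by positivity) (by linarith) 4
  linarith

theorem isAsymptoticallyFlat_of_end {a s₁ r₁ m Q : ℝ} {F G : ℝ → ℝ} (has : a < s₁)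
    (hFs : ∀ s ≥ s₁, ContDiffAt ℝ ∞ F s ∧ 0 < F s ∧ 0 < deriv F s)
    (hG : ContDiff ℝ ∞ G) (hGm : StrictMono G) (hGF : ∀ r ≥ r₁, s₁ ≤ G r ∧ F (G r) = r)
    (hFG : ∀ s ≥ s₁, r₁ ≤ F s ∧ G (F s) = s)
    (hF' : ∀ s ≥ s₁, deriv F s = Real.sqrt (1 - 2 * m / F s + Q ^ 2 / F s ^ 2))
    (hscal : ∀ p : Cyl, s₁ < p.1 →
      scalarCurvature (cyl (Ici a)) (rotMetric F) p = 2 * Q ^ 2 / F p.1 ^ 4) :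
    IsAsymptoticallyFlat (cyl (Ici a)) (rotMetric F) (radialField fun s => Q / F s ^ 2) := by
  -- `R ≥ r₁` puts the chart in the Reissner–Nordström end, `R ≥ 1` allows decay to be weakened, and
  -- `R ≥ 4m` keeps `1 - 2m/r + Q²/r²` at least `1/2`.
  set R := max r₁ (max 1 (4 * m)) with hR
  have hRr : r₁ ≤ R := le_max_left _ _
  have hR1 : 1 ≤ R := (le_max_left _ _).trans (le_max_right _ _)
  have hR4 : 4 * m ≤ R := (le_max_right _ _).trans (le_max_right _ _)
  have hx0 : ∀ x : E3, R < ‖x‖ → x ≠ 0 := fun x hx => norm_pos_iff.1 (by linarith)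
  have hGr : ∀ r > R, s₁ < G r ∧ F (G r) = r := fun r hr =>
    ⟨(hGF r₁ le_rfl).1.trans_lt (hGm (by linarith)), (hGF r (by linarith)).2⟩
  -- Differentiating `F ∘ G = id` gives `G' = 1/F' = V^(-1/2)`.
  have hGd : ∀ r > R, HasDerivAt G (Real.sqrt (1 - 2 * m / r + Q ^ 2 / r ^ 2))⁻¹ r := fun r hr => by
    have h1 := (hG.differentiable (by simp) r).hasDerivAt
    obtain ⟨h2, h3⟩ := hGr r hr
    have h4 := (((hFs _ h2.le).1.differentiableAt (by simp)).hasDerivAt).comp r h1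
    have h5 : F ∘ G =ᶠ[nhds r] id := by
      filter_upwards [lt_mem_nhds hr] with x hx using (hGr x hx).2
    have h6 := h4.unique ((hasDerivAt_id r).congr_of_eventuallyEq h5)
    have h7 := (hFs _ h2.le).2.2
    rw [hF' _ h2.le, h3] at h6 h7
    rwa [← eq_inv_of_mul_eq_one_right h6]
  have himage : endChart G '' {x | R < ‖x‖} = cyl (Ioi (G R)) := by
    ext ⟨s, θ⟩
    constructor
    · rintro ⟨x, hx, h⟩
      rw [← h]
      exact ⟨hGm hx, trivial⟩
    · rintro ⟨hs, -⟩
      have hs' : G R < s := hs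
      have hs1 : s₁ < s := (hGF R hRr).1.trans_lt hs'
      have h1 := (hFG s hs1.le).2
      have h2 : R < F s := by rwa [← hGm.lt_iff_lt, h1]
      have h3 : ‖F s • (θ : E3)‖ = F s := by
        rw [norm_smul, norm_eq_of_mem_sphere, mul_one, Real.norm_of_nonneg (by linarith)]
      refine ⟨F s • (θ : E3), by rwa [mem_ofPred_eq, h3], ?_⟩
      rw [endChart, h3, h1, sphereDir_smul (by linarith)]
  have hmet : ∀ i j x, R < ‖x‖ → afMetric (rotMetric F) (endChart G) i j x =
      x i * x j * ((2 * m * ‖x‖ - Q ^ 2) *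
        (‖x‖⁻¹ * ‖x‖⁻¹ * (‖x‖ ^ 2 - 2 * m * ‖x‖ + Q ^ 2)⁻¹)) + if i = j then 1 else 0 := by
    intro i j x hx
    have h0 : 0 < ‖x‖ := by linarith
    have h1 := half_sq_le_rn (m := m) (Q := Q) h0 (by linarith)
    have h2 : 0 < ‖x‖ ^ 2 - 2 * m * ‖x‖ + Q ^ 2 := lt_of_lt_of_le (by positivity) h1
    have h3 : 1 - 2 * m / ‖x‖ + Q ^ 2 / ‖x‖ ^ 2 =
        (‖x‖ ^ 2 - 2 * m * ‖x‖ + Q ^ 2) / ‖x‖ ^ 2 := by field_simp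
    rw [afMetric_endChart (hGd _ hx) (hx0 x hx) (hGr _ hx).2, h3, inv_pow, Real.sq_sqrt
      (by positivity), add_comm]
    have h4 : 2 * m * ‖x‖ - Q ^ 2 = ‖x‖ ^ 2 - (‖x‖ ^ 2 - 2 * m * ‖x‖ + Q ^ 2) := by ring
    rw [h4]
    generalize ‖x‖ ^ 2 - 2 * m * ‖x‖ + Q ^ 2 = D at h2
    congr 2
    field_simp
  have hfld : ∀ i x, R < ‖x‖ →
      afField (radialField fun s => Q / F s ^ 2) (endChart G) (endChartInv F) i x =
      Q * (Real.sqrt (1 - 2 * m / ‖x‖ + Q ^ 2 / ‖x‖ ^ 2) *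
        (x i * (‖x‖⁻¹ * ‖x‖⁻¹ * ‖x‖⁻¹))) := by
    intro i x hx
    obtain ⟨h2, h3⟩ := hGr _ hx
    have h0 : 0 < ‖x‖ := by linarith
    rw [afField_endChart (hx0 x hx) (hFs _ h2.le).1, hF' _ h2.le, h3]
    field_simp
  have hmd : ∀ i j, HasDecay R 2 (-1) _ := hasDecay_rn_metric (m := m) (Q := Q) hR1 hR4 2
  have hfd : ∀ i, HasDecay R 1 (-2) _ := hasDecay_rn_field (m := m) (Q := Q) hR1 hR4 1
  have hp1 : ∀ i j k x, R < ‖x‖ → partialE3 k (afMetric (rotMetric F) (endChart G) i j) x = _ :=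
    fun i j k x hx => (partialE3_congr (hmet i j) k hx).trans
      (by rw [partialE3, fderiv_add_const])
  obtain ⟨C₁, h₁⟩ := exists_uniform_bound fun i : Fin 3 × Fin 3 => (hmd i.1 i.2).bound
  obtain ⟨C₂, h₂⟩ := exists_uniform_bound fun i : Fin 3 × Fin 3 × Fin 3 =>
    ((hmd i.1 i.2.1).2.2 i.2.2).bound
  obtain ⟨C₃, h₃⟩ := exists_uniform_bound fun i : Fin 3 × Fin 3 × Fin 3 × Fin 3 =>
    (((hmd i.1 i.2.1).2.2 i.2.2.1).2.2 i.2.2.2).bound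
  obtain ⟨C₄, h₄⟩ := exists_uniform_bound fun i : Fin 3 => (hfd i).bound
  obtain ⟨C₅, h₅⟩ := exists_uniform_bound fun i : Fin 3 × Fin 3 => ((hfd i.1).2.2 i.2).bound
  have hC : ∀ {A x : ℝ} (n : ℕ) (c : ℝ), 0 ≤ x → A ≤ c * x ^ (-(n : ℤ)) →
      c ≤ |C₁| + |C₂| + |C₃| + |C₄| + |C₅| → A ≤ (|C₁| + |C₂| + |C₃| + |C₄| + |C₅|) / x ^ n := by
    intro A x n c hx hA hc
    rw [zpow_neg, zpow_natCast, ← div_eq_mul_inv] at hA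
    exact hA.trans (div_le_div_of_nonneg_right hc (by positivity))
  refine ⟨R, |C₁| + |C₂| + |C₃| + |C₄| + |C₅|, endChart G, endChartInv F, by linarith, ?_, ?_, ?_,
    ?_, ?_, ?_, ?_, ?_⟩
  · intro x hx
    exact ⟨(has.trans (hGr _ hx).1).le, trivial⟩
  · rw [himage]
    have : cyl (Ici a) \ cyl (Ioi (G R)) = Icc a (G R) ×ˢ univ := by
      ext ⟨s, θ⟩
      simp [cyl]
    rw [this]
    exact isCompact_Icc.prod isCompact_univ
  · rw [himage]
    exact isOpen_Ioi.prod isOpen_univ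
  · intro x hx
    rw [endChartInv, endChart, (hGr _ hx).2, coe_sphereDir (hx0 x hx),
      smul_inv_smul₀ (norm_ne_zero_iff.2 (hx0 x hx))]
  · exact fun x hx => (contMDiffAt_endChart hG (hx0 x hx)).contMDiffWithinAt
  · rw [himage]
    intro p hp
    have hp1 : G R < p.1 := hp.1
    exact (contMDiffAt_endChartInv
      (hFs p.1 ((hGF R hRr).1.trans hp1.le)).1).contMDiffWithinAt
  · intro x hx i j k l
    have hn := norm_nonneg x
    have a₁ := le_abs_self C₁
    have a₂ := le_abs_self C₂
    have a₃ := le_abs_self C₃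
    have a₄ := le_abs_self C₄
    have a₅ := le_abs_self C₅
    have b₁ := abs_nonneg C₁
    have b₂ := abs_nonneg C₂
    have b₃ := abs_nonneg C₃
    have b₄ := abs_nonneg C₄
    have b₅ := abs_nonneg C₅
    refine ⟨?_, ?_, ?_, ?_, ?_⟩
    · rw [← pow_one ‖x‖]
      refine hC 1 C₁ hn ?_ (by linarith)
      rw [hmet i j x hx, add_sub_cancel_right]
      exact h₁ (i, j) x hx
    · refine hC 2 C₂ hn ?_ (by linarith)
      rw [hp1 i j k x hx]
      exact h₂ (i, j, k) x hx
    · refine hC 3 C₃ hn ?_ (by linarith)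
      rw [partialE3_congr (hp1 i j k) l hx]
      exact h₃ (i, j, k, l) x hx
    · refine hC 2 C₄ hn ?_ (by linarith)
      rw [hfld i x hx]
      exact h₄ i x hx
    · refine hC 3 C₅ hn ?_ (by linarith)
      rw [partialE3_congr (hfld i) k hx]
      exact h₅ (i, k) x hx
  -- On the end the scalar curvature is `2Q²/|x|⁴`, integrable in dimension three.
  · refine (integrableOn_exterior_inv_pow_four (2 * Q ^ 2) hR1).congr_fun (fun x hx => ?_)
      (isOpen_lt continuous_const continuous_norm).measurableSet
    obtain ⟨h2, h3⟩ := hGr _ hx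
    simp only [hscal (endChart G x) h2]
    rw [endChart, h3]

/-! ### Isometry of the end with Reissner–Nordström. -/

/-- The map `(s, θ) ↦ (F(s), θ)`. -/
def radialMap (F : ℝ → ℝ) (p : Cyl) : Cyl := (F p.1, p.2)

theorem contMDiffAt_radialMap {F : ℝ → ℝ} {p : Cyl} (hF : ContDiffAt ℝ ∞ F p.1) :
    ContMDiffAt cylModel cylModel ∞ (radialMap F) p :=
  (hF.contMDiffAt.comp p contMDiffAt_fst).prodMk contMDiffAt_snd

theorem mfderivWithin_radialMap {F : ℝ → ℝ} {p : Cyl} {s₁ : ℝ} (hF : ContDiffAt ℝ ∞ F p.1)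
    (hp : p ∈ cyl (Ici s₁)) (v : TangentSpace cylModel p) :
    mfderivWithin cylModel cylModel (radialMap F) (cyl (Ici s₁)) p v =
      ((deriv F p.1 * (v : CylV).1, (v : CylV).2) : CylV) := by
  have hu : UniqueMDiffWithinAt cylModel (cyl (Ici s₁)) p :=
    ((uniqueDiffOn_Ici s₁).uniqueMDiffOn.prod (uniqueMDiffOn_univ (I := 𝓡 2))) p hp
  have h1 : HasMFDerivAt cylModel 𝓘(ℝ, ℝ) (Prod.fst : Cyl → ℝ) p _ := hasMFDerivAt_fst p
  have h2 : HasMFDerivAt cylModel (𝓡 2) (Prod.snd : Cyl → S2) p _ := hasMFDerivAt_snd p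
  have h3 : HasMFDerivAt 𝓘(ℝ, ℝ) 𝓘(ℝ, ℝ) F p.1 _ :=
    ((hF.differentiableAt (by simp)).hasDerivAt).hasFDerivAt.hasMFDerivAt
  have h4 := (h3.comp p h1).prodMk h2
  rw [mfderivWithin_eq_mfderiv hu ((contMDiffAt_radialMap hF).mdifferentiableAt (by simp))]
  refine (congrArg (fun A => A v) h4.mfderiv).trans ?_
  refine Prod.ext ?_ rfl
  exact mul_comm _ _

/-- Under `r = F(s)` the equation `F' = √V` turns `V⁻¹ dr²` into `ds²` and carries `Q F⁻² ∂_s` to `Q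
r⁻² √V ∂_r`. -/
theorem isChargedIsometry_radialMap {s₁ r₁ m Q : ℝ} {F G : ℝ → ℝ}
    (hFs : ∀ s ≥ s₁, ContDiffAt ℝ ∞ F s ∧ 0 < F s ∧ 0 < deriv F s)
    (hG : ContDiff ℝ ∞ G) (hGF : ∀ r ≥ r₁, s₁ ≤ G r ∧ F (G r) = r)
    (hFG : ∀ s ≥ s₁, r₁ ≤ F s ∧ G (F s) = s)
    (hF' : ∀ s ≥ s₁, deriv F s = Real.sqrt (1 - 2 * m / F s + Q ^ 2 / F s ^ 2)) :
    IsChargedIsometry (cyl (Ici s₁)) (rotMetric F) (radialField fun s => Q / F s ^ 2)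
      (cyl (Ici r₁)) (rnMetric m Q) (rnField m Q) (radialMap F) := by
  have hmaps : MapsTo (radialMap F) (cyl (Ici s₁)) (cyl (Ici r₁)) := fun p hp =>
    ⟨(hFG p.1 hp.1).1, trivial⟩
  have hmaps' : MapsTo (radialMap G) (cyl (Ici r₁)) (cyl (Ici s₁)) := fun p hp =>
    ⟨(hGF p.1 hp.1).1, trivial⟩
  have hinv : InvOn (radialMap G) (radialMap F) (cyl (Ici s₁)) (cyl (Ici r₁)) :=
    ⟨fun p hp => Prod.ext (hFG p.1 hp.1).2 rfl, fun p hp => Prod.ext (hGF p.1 hp.1).2 rfl⟩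
  refine ⟨hinv.bijOn hmaps hmaps',
    fun p hp => (contMDiffAt_radialMap (hFs p.1 hp.1).1).contMDiffWithinAt,
    ⟨radialMap G, fun p _ => (contMDiffAt_radialMap hG.contDiffAt).contMDiffWithinAt, hinv⟩,
    fun p hp => ⟨fun v w => ?_, ?_⟩⟩
  · have h0 := (hFs p.1 hp.1).2.2
    have hN : 0 < 1 - 2 * m / F p.1 + Q ^ 2 / F p.1 ^ 2 := by
      rwa [hF' p.1 hp.1, Real.sqrt_pos] at h0
    rw [mfderivWithin_radialMap (hFs p.1 hp.1).1 hp, mfderivWithin_radialMap (hFs p.1 hp.1).1 hp]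
    simp only [rnMetric, rotMetric, warpedMetric, radialMap]
    have h1 : (1 - 2 * m / F p.1 + Q ^ 2 / F p.1 ^ 2)⁻¹ * deriv F p.1 ^ 2 = 1 := by
      rw [hF' p.1 hp.1, Real.sq_sqrt hN.le, inv_mul_cancel₀ hN.ne']
    congr 1
    linear_combination ((v : CylV).1 * (w : CylV).1) * h1
  · rw [mfderivWithin_radialMap (hFs p.1 hp.1).1 hp]
    simp only [radialField, rnField, radialMap]
    rw [hF' p.1 hp.1, mul_comm]

theorem rotMetric_radialField (F φ : ℝ → ℝ) (p : Cyl) :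
    rotMetric F p (radialField φ p) (radialField φ p) = φ p.1 ^ 2 := by
  have h : roundMetric p.2 (0 : EuclideanSpace ℝ (Fin 2)) (0 : EuclideanSpace ℝ (Fin 2)) = 0 := by
    rw [roundMetric_eq]; simp
  simp only [rotMetric, warpedMetric, radialField]
  erw [h]
  ring

/-- Replaces the outer radius by `2m`, the bound that the construction of the radius function
supplies. -/
theorem rPlus_le {m Q : ℝ} (hm : 0 ≤ m) : rPlus m Q ≤ 2 * m := by
  have : Real.sqrt (m ^ 2 - Q ^ 2) ≤ m :=
    (Real.sqrt_le_sqrt (by linarith [sq_nonneg Q])).trans (Real.sqrt_sq hm).le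
  rw [rPlus]
  linarith

section

variable {I : Set ℝ} {F : ℝ → ℝ}

theorem hasDerivWithinAt_of_contDiffOn (hF : ContDiffOn ℝ ∞ F I) {s : ℝ} (hs : s ∈ I) :
    HasDerivWithinAt F (derivWithin F I s) I s :=
  (hF.differentiableOn (by simp) s hs).hasDerivWithinAt

theorem hasDerivWithinAt_derivWithin_of_contDiffOn (hI : UniqueDiffOn ℝ I)
    (hF : ContDiffOn ℝ ∞ F I) {s : ℝ} (hs : s ∈ I) :
    HasDerivWithinAt (derivWithin F I) (derivWithin (derivWithin F I) I s) I s :=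
  hasDerivWithinAt_of_contDiffOn (hF.derivWithin hI (by simp)) hs

theorem dec_iff {F₀ F₁ F₂ Q : ℝ} (hF : 0 < F₀) :
    2 * (Q / F₀ ^ 2) ^ 2 ≤ 2 / F₀ ^ 2 * (1 - F₁ ^ 2 - 2 * F₀ * F₂) ↔
      0 ≤ 1 - F₁ ^ 2 - 2 * F₀ * F₂ - Q ^ 2 / F₀ ^ 2 := by
  rw [show 2 * (Q / F₀ ^ 2) ^ 2 = 2 / F₀ ^ 2 * (Q ^ 2 / F₀ ^ 2) by field_simp,
    mul_le_mul_iff_right₀ (by positivity), sub_nonneg]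

end

end

/-! ### Assembly of the extension. -/

theorem mainTheorem3 (a b Q : ℝ) (hab : a < b) (f : ℝ → ℝ)
    (hf : ContDiffOn ℝ ∞ f (Icc a b)) (hpos : ∀ s ∈ Icc a b, 0 < f s)
    (hR : ∀ p ∈ cyl (Icc a b),
      2 * rotMetric f p (electricField Q f p) (electricField Q f p) <
        scalarCurvature (cyl (Icc a b)) (rotMetric f) p)
    (hfb : |Q| < f b)
    (hH : ∀ p ∈ coordSphere b, 0 < meanCurvature (cyl (Icc a b)) (rotMetric f) p)
    (hmass : |Q| < chargedHawkingMass (cyl (Icc a b)) (rotMetric f) (electricField Q f) b)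
    (m : ℝ)
    (hm : chargedHawkingMass (cyl (Icc a b)) (rotMetric f) (electricField Q f) b < m) :
    -- the rotationally symmetric charged manifold `M = [a, ∞) × S²`, `γ = ds² + F² g_*`, `E = φ ∂_s`
    ∃ F φ : ℝ → ℝ,
      ContDiffOn ℝ ∞ F (Ici a) ∧ (∀ s ∈ Ici a, 0 < F s) ∧ ContDiffOn ℝ ∞ φ (Ici a) ∧
      IsAsymptoticallyFlat (cyl (Ici a)) (rotMetric F) (radialField φ) ∧
      (∀ p ∈ cyl (Ici a), divergence (cyl (Ici a)) (rotMetric F) (radialField φ) p = 0) ∧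
      (∀ p ∈ cyl (Ici a), 2 * rotMetric F p (radialField φ p) (radialField φ p) ≤
        scalarCurvature (cyl (Ici a)) (rotMetric F) p) ∧
      -- near the boundary it is the given charged manifold
      (∀ p ∈ cyl (Icc a ((a + b) / 2)),
        rotMetric F p = rotMetric f p ∧ radialField φ p = electricField Q f p) ∧
      -- outside a neighborhood of the boundary it is Reissner–Nordström
      ∃ (s₁ r₁ : ℝ) (Φ : Cyl → Cyl), a < s₁ ∧ rPlus m Q < r₁ ∧
        IsChargedIsometry (cyl (Ici s₁)) (rotMetric F) (radialField φ)
          (cyl (Ici r₁)) (rnMetric m Q) (rnField m Q) Φ ∧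
        -- foliation by the mean-convex spheres `Σ_s`
        ((∀ s ∈ Icc a b, 0 < derivWithin f (Icc a b) s) →
          (∀ p ∈ cyl (Ici a), 0 < meanCurvature (cyl (Ici a)) (rotMetric F) p) ∧
          ∀ s ∈ Ici s₁, ∃ r ∈ Ici r₁, Φ '' coordSphere s = coordSphere r) := by

  have huI := uniqueDiffOn_Icc hab
  have huM := uniqueDiffOn_Ici a
  have hbI : b ∈ Icc a b := right_mem_Icc.2 hab.le
  set f₁ := derivWithin f (Icc a b) with hf₁
  set f₂ := derivWithin f₁ (Icc a b) with hf₂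
  have hd₁ : ∀ s ∈ Icc a b, HasDerivWithinAt f (f₁ s) (Icc a b) s := fun s hs =>
    hasDerivWithinAt_of_contDiffOn hf hs
  have hd₂ : ∀ s ∈ Icc a b, HasDerivWithinAt f₁ (f₂ s) (Icc a b) s := fun s hs =>
    hasDerivWithinAt_derivWithin_of_contDiffOn huI hf hs
  -- By symmetry any point of the sphere serves to turn pointwise hypotheses into inequalities for
  -- `f`.
  let θ : S2 := ⟨EuclideanSpace.single 0 1, by simp⟩
  have hdec : ∀ s ∈ Icc a b, 0 ≤ 1 - f₁ s ^ 2 - 2 * f s * f₂ s - Q ^ 2 / f s ^ 2 := fun s hs => by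
    have hp : ((s, θ) : Cyl) ∈ cyl (Icc a b) := ⟨hs, trivial⟩
    have := (hR _ hp).le
    rw [electricField, rotMetric_radialField,
      scalarCurvature_rotMetric huI hpos hd₁ (hd₂ s hs) hp] at this
    exact (dec_iff (hpos s hs)).1 this
  have hwithin : ∀ s ∈ Ioo a b, f₁ =ᶠ[nhds s] deriv f := fun s hs => by
    filter_upwards [Ioo_mem_nhds hs.1 hs.2] with x hx
    exact derivWithin_of_mem_nhds (Icc_mem_nhds hx.1 hx.2)
  have hdec' : ∀ s ∈ Ioo a b,
      0 ≤ 1 - deriv f s ^ 2 - 2 * f s * deriv (deriv f) s - Q ^ 2 / f s ^ 2 := fun s hs => by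
    have h1 := hdec s (Ioo_subset_Icc_self hs)
    rwa [hf₂, derivWithin_of_mem_nhds (Icc_mem_nhds hs.1 hs.2), (hwithin s hs).deriv_eq,
      (hwithin s hs).eq_of_nhds] at h1
  have hd : 0 < f₁ b := by
    have hp : ((b, θ) : Cyl) ∈ coordSphere b := ⟨mem_singleton b, trivial⟩
    have := hH _ hp
    rw [meanCurvature_rotMetric huI hpos hd₁ ⟨hbI, trivial⟩, div_pos_iff_of_pos_right
      (hpos b hbI)] at this
    linarith
  rw [chargedHawkingMass_rotMetric huI hpos hd₁ hbI] at hm hmass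
  have hm0 : 0 < m := ((abs_nonneg Q).trans_lt hmass).trans hm
  obtain ⟨F, G, s₀, c₁, s₁, r₁, hs₀, hc₁, hc₁b, hs₁, hr₁, hFf, hF, hG, hGm, hGF, hFG, hF'⟩ :=
    exists_profile hab hf hpos hdec' hfb hd hmass hm
  have hFs : ∀ s ≥ s₁, ContDiffAt ℝ ∞ F s ∧ 0 < F s ∧ 0 < deriv F s := fun s hs =>
    have h := hF s (by linarith)
    ⟨h.1, h.2.1, h.2.2.1⟩
  -- Beyond `s₀` smoothness comes from the construction; up to `s₀ < c₁` it is inherited from `f`,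
  -- one-sidedly at `a`. The overlap `(s₀, c₁)` makes the two cases cover all points.
  have hFsmooth : ContDiffOn ℝ ∞ F (Ici a) := fun s hs => by
    rcases lt_or_ge s₀ s with h | h
    · exact (hF s h).1.contDiffWithinAt
    · have hs' : s < c₁ := by linarith
      have h1 : ContDiffWithinAt ℝ ∞ f (Ici a) s :=
        (hf s ⟨hs, by linarith⟩).mono_of_mem_nhdsWithin (by
          filter_upwards [self_mem_nhdsWithin, mem_nhdsWithin_of_mem_nhds
            (gt_mem_nhds (hs'.trans hc₁b))] with x hx hx' using ⟨hx, le_of_lt hx'⟩)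
      refine h1.congr_of_eventuallyEq ?_ (hFf s hs'.le)
      filter_upwards [mem_nhdsWithin_of_mem_nhds (gt_mem_nhds hs')] with x hx using hFf x hx.le
  have hFpos : ∀ s ∈ Ici a, 0 < F s := fun s hs => by
    rcases lt_or_ge s₀ s with h | h
    · exact (hF s h).2.1
    · rw [hFf s (by linarith)]
      exact hpos s ⟨hs, by linarith⟩
  set F₁ := derivWithin F (Ici a) with hF₁
  set F₂ := derivWithin F₁ (Ici a) with hF₂
  have hD₁ : ∀ s ∈ Ici a, HasDerivWithinAt F (F₁ s) (Ici a) s := fun s hs =>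
    hasDerivWithinAt_of_contDiffOn hFsmooth hs
  have hD₂ : ∀ s ∈ Ici a, HasDerivWithinAt F₁ (F₂ s) (Ici a) s := fun s hs =>
    hasDerivWithinAt_derivWithin_of_contDiffOn huM hFsmooth hs
  have hset : ∀ s < b, Ici a =ᶠ[nhds s] Icc a b := fun s hs => by
    filter_upwards [gt_mem_nhds hs] with x hx
    exact propext ⟨fun h => ⟨h, hx.le⟩, fun h => h.1⟩
  have hleft₁ : ∀ s < c₁, F₁ s = f₁ s := fun s hs => by
    rw [hF₁, hf₁, derivWithin_congr_set (hset s (hs.trans hc₁b))]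
    refine Filter.EventuallyEq.derivWithin_eq ?_ (hFf s hs.le)
    filter_upwards [mem_nhdsWithin_of_mem_nhds (gt_mem_nhds hs)] with x hx using hFf x hx.le
  have hleft₂ : ∀ s < c₁, F₂ s = f₂ s := fun s hs => by
    rw [hF₂, hf₂, derivWithin_congr_set (hset s (hs.trans hc₁b))]
    refine Filter.EventuallyEq.derivWithin_eq ?_ (hleft₁ s hs)
    filter_upwards [mem_nhdsWithin_of_mem_nhds (gt_mem_nhds hs)] with x hx using hleft₁ x hx
  have hright : ∀ s > s₀, F₁ =ᶠ[nhds s] deriv F := fun s hs => by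
    have ha : a < s := by linarith
    filter_upwards [lt_mem_nhds ha] with x hx using derivWithin_of_mem_nhds (Ici_mem_nhds hx)
  have hright₁ : ∀ s > s₀, F₁ s = deriv F s := fun s hs => (hright s hs).eq_of_nhds
  have hright₂ : ∀ s > s₀, F₂ s = deriv (deriv F) s := fun s hs => by
    have ha : a < s := by linarith
    rw [hF₂, derivWithin_of_mem_nhds (Ici_mem_nhds ha), (hright s hs).deriv_eq]
  have hscalar : ∀ p ∈ cyl (Ici a), scalarCurvature (cyl (Ici a)) (rotMetric F) p =
      2 / F p.1 ^ 2 * (1 - F₁ p.1 ^ 2 - 2 * F p.1 * F₂ p.1) := fun p hp =>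
    scalarCurvature_rotMetric huM hFpos hD₁ (hD₂ p.1 hp.1) hp
  have hrn : ∀ p : Cyl, s₁ < p.1 →
      scalarCurvature (cyl (Ici a)) (rotMetric F) p = 2 * Q ^ 2 / F p.1 ^ 4 := by
    intro p hp
    have hs : p.1 > s₀ := by linarith
    obtain ⟨h1, h2, h3, -⟩ := hF p.1 hs
    have h4 := hasDerivAt_radialMass (Q := Q) (F := F) (F₁ := deriv F)
      (h1.differentiableAt (by simp)).hasDerivAt
      ((h1.derivWithin (m := ∞) (by simp)).differentiableAt (by simp)).hasDerivAt h2.ne'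
    -- The mass is constant on the end, so its derivative vanishes and the energy condition is an
    -- equality: `R = 2|E|² = 2Q²/F⁴`.
    have h5 : (fun s => radialMass Q (F s) (deriv F s)) =ᶠ[nhds p.1] fun _ => m := by
      filter_upwards [lt_mem_nhds hp] with x hx
      have h6 := (hFs x hx.le).2.1
      have h7 := (hFs x hx.le).2.2
      rw [hF' x hx.le, Real.sqrt_pos] at h7
      rw [hF' x hx.le, radialMass, Real.sq_sqrt h7.le]
      field_simp
      ring
    have h6 := (h4.unique ((hasDerivAt_const p.1 m).congr_of_eventuallyEq h5))
    have h7 := (mul_eq_zero.1 h6).resolve_left (half_pos h3).ne'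
    rw [hscalar p ⟨show a ≤ p.1 by linarith, trivial⟩, hright₁ p.1 hs, hright₂ p.1 hs, sub_eq_zero.1 h7]
    field_simp
  have has₁ : a < s₁ := by linarith
  refine ⟨F, fun s => Q / F s ^ 2, hFsmooth, hFpos,
    contDiffOn_const.div (hFsmooth.pow 2) fun s hs => pow_ne_zero 2 (hFpos s hs).ne',
    isAsymptoticallyFlat_of_end has₁ hFs hG hGm hGF hFG hF' hrn, fun p hp => ?_, fun p hp => ?_,
    fun p hp => ?_, s₁, r₁, radialMap F, has₁, (rPlus_le hm0.le).trans_lt hr₁,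
    isChargedIsometry_radialMap hFs hG hGF hFG hF', fun hinc => ⟨fun p hp => ?_, fun s hs => ?_⟩⟩
  -- The divergence is `φ' + 2(F'/F)φ`, which vanishes because `F²φ = Q` is constant.
  · have h0 := hFpos p.1 hp.1
    have hφ := (hasDerivWithinAt_const p.1 (Ici a) Q).fun_div ((hD₁ p.1 hp.1).fun_pow 2)
      (pow_ne_zero 2 h0.ne')
    rw [divergence_radialField huM hFpos hD₁ hφ hp]
    simp
    field_simp
    ring
  · rw [rotMetric_radialField, hscalar p hp, dec_iff (hFpos p.1 hp.1)]
    rcases lt_or_ge s₀ p.1 with h | h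
    · rw [hright₁ _ h, hright₂ _ h]
      exact (hF p.1 h).2.2.2
    · have hc : p.1 < c₁ := by linarith
      rw [hleft₁ _ hc, hleft₂ _ hc, hFf _ hc.le]
      exact hdec p.1 ⟨hp.1, by linarith⟩
  · have hc : p.1 ≤ c₁ := by linarith [hp.1.2]
    refine ⟨?_, ?_⟩
    · funext v w
      simp only [rotMetric, warpedMetric, hFf _ hc]
    · simp only [electricField, radialField, hFf _ hc]
      rfl
  · rw [meanCurvature_rotMetric huM hFpos hD₁ hp]
    refine div_pos (mul_pos two_pos ?_) (hFpos p.1 hp.1)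
    rcases lt_or_ge s₀ p.1 with h | h
    · rw [hright₁ _ h]
      exact (hF p.1 h).2.2.1
    · rw [hleft₁ _ (by linarith)]
      exact hinc p.1 ⟨hp.1, by linarith⟩
  · refine ⟨F s, (hFG s hs).1, ?_⟩
    ext ⟨r, θ⟩
    constructor
    · rintro ⟨⟨t, θ'⟩, ⟨ht, -⟩, h⟩
      rw [← h]
      exact ⟨congrArg F ht, trivial⟩
    · rintro ⟨h, -⟩
      exact ⟨(s, θ), ⟨mem_singleton s, trivial⟩, Prod.ext h.symm rfl⟩
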